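/- Let $q$ be a prime number and let $s\ge 1$ be an integer. Let $\mathbb{Z}_q=\{0,1,\ldots,q-1\}$ be the field of order $q$, let $\mathbb{Z}_q((x^{-1}))$ be the field of formal Laurent series $g=\sum_{k\ge w}a_kx^{-k}$ ($w\in\mathbb{Z}$, $a_k\in\mathbb{Z}_q$), and for such $g$ put $\{g\}=\sum_{k\ge \max(1,w)}a_kx^{-k}$ and $\{g\}_{|x=q}=\sum_{k\ge\max(1,w)}a_kq^{-k}\in[0,1]$, where in the last sum the $a_k$ are read as integers. Let $\overline{\mathbb{Z}}_q((x^{-1}))$ be the compact additive group of all $g$ with $g=\{g\}$, let $\mu$ be its normalized Haar measure, and let $\mu_s$ be the $s$-fold product measure of $\mu$ on $(\overline{\mathbb{Z}}_q((x^{-1})))^s$. For $\boldsymbol f=(f_1,\ldots,f_s)\in(\overline{\mathbb{Z}}_q((x^{-1})))^s$ the digital Kronecker-sequence $\mathcal{S}(\boldsymbol f)=(\boldsymbol x_n)_{n\ge 0}$ is given by $$\boldsymbol x_n=\bigl(\{n(x)f_1(x)\}_{|x=q},\ldots,\{n(x)f_s(x)\}_{|x=q}\bigr),$$ where $n(x)=n_0+n_1x+\cdots+n_rx^r\in\mathbb{Z}_q[x]$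 for a nonnegative integer $n$ with base $q$ expansion $n=n_0+n_1q+\cdots+n_rq^r$. For a positive integer $N$ its (unnormalized) star discrepancy is $$D_N^\ast(\mathcal{S}(\boldsymbol f))=\sup_{\boldsymbol t\in[0,1]^s}\Bigl|\#\bigl\{0\le n<N:\boldsymbol x_n\in\textstyle\prod_{j=1}^s[0,t_j)\bigr\}-N\,t_1\cdots t_s\Bigr|.$$ Then there is a constant $c(q,s)>0$, depending only on $q$ and $s$, such that for $\mu_s$-almost all $\boldsymbol f\in(\overline{\mathbb{Z}}_q((x^{-1})))^s$ $$D_N^\ast(\mathcal{S}(\boldsymbol f))\ \ge\ c(q,s)\,(\log N)^s\log\log N\qquad\text{for infinitely many positive integers } N .$$ -/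

import Mathlib

open MeasureTheory

namespace DigitalKronecker

noncomputable section

/-! ### Formal Laurent series in `x⁻¹`

`ℤ_q((x⁻¹))` is `LaurentSeries (ZMod q)`, the formal variable being `x⁻¹`: the series
`∑_{k ≥ w} a_k x^{-k}` has `coeff k = a_k`, and `x` itself is `HahnSeries.single (-1) 1`. The
topology is the valuation topology that Mathlib puts on Laurent series over a field. -/

/-- The polynomial `n(x) = n_0 + n_1 x + ⋯ + n_r x^r` over `ℤ_q` associated with the
nonnegative integer `n = n_0 + n_1 q + ⋯ + n_r q^r` (base `q` expansion). -/
def digitPoly (q n : ℕ) : Polynomial (ZMod q) :=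
  ∑ i ∈ Finset.range (Nat.digits q n).length,
    Polynomial.monomial i (((Nat.digits q n).getD i 0 : ℕ) : ZMod q)

/-- A polynomial in `x`, regarded as an element of `ℤ_q((x⁻¹))`. -/
def polyToLaurent (q : ℕ) (p : Polynomial (ZMod q)) : LaurentSeries (ZMod q) :=
  p.eval₂ HahnSeries.C (HahnSeries.single (-1 : ℤ) (1 : ZMod q))

/-- The fractional part `{g} = ∑_{k ≥ 1} a_k x^{-k}` of `g = ∑_{k ≥ w} a_k x^{-k}`. -/
def fracPart {q : ℕ} (g : LaurentSeries (ZMod q)) : LaurentSeries (ZMod q) :=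
  HahnSeries.ofSuppBddBelow (fun k : ℤ => if 1 ≤ k then g.coeff k else 0)
    ⟨1, fun k hk => by
      by_contra h
      exact hk (if_neg h)⟩

/-- The value at `x = q` of a fractional series `∑_{k ≥ 1} a_k x^{-k}`, that is the real number
`∑_{k ≥ 1} a_k q^{-k}`, the coefficients being read as integers in `{0, …, q - 1}`. -/
def evalAtBase {q : ℕ} (g : LaurentSeries (ZMod q)) : ℝ :=
  ∑' k : ℕ, ((g.coeff ((k : ℤ) + 1)).val : ℝ) / (q : ℝ) ^ (k + 1)

/-- The digital Kronecker-sequence `S(f)`: its `n`-th point has the coordinates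
`{n(x) f_j(x)}` evaluated at `x = q`, `j = 1, …, s`. -/
def kroneckerSeq {q s : ℕ} (f : Fin s → LaurentSeries (ZMod q)) (n : ℕ) : Fin s → ℝ :=
  fun j => evalAtBase (fracPart (polyToLaurent q (digitPoly q n) * f j))

/-! ### Star discrepancy -/

open Classical in
/-- The local discrepancy `#{0 ≤ n < N : y_n ∈ [0, x)} - N x_1 ⋯ x_s` of a sequence `y`. -/
def localDiscrepancy {s : ℕ} (y : ℕ → Fin s → ℝ) (x : Fin s → ℝ) (N : ℕ) : ℝ :=
  (((Finset.range N).filter (fun n => ∀ j, 0 ≤ y n j ∧ y n j < x j)).card : ℝ)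
    - (N : ℝ) * ∏ j, x j

/-- The local discrepancy is bounded on `[0,1]^s`, so that the supremum in the star discrepancy is
a genuine one. -/
theorem abs_localDiscrepancy_le {s : ℕ} (y : ℕ → Fin s → ℝ) (x : Fin s → ℝ)
    (hx : x ∈ Set.Icc (0 : Fin s → ℝ) 1) (N : ℕ) : |localDiscrepancy y x N| ≤ N := by
  classical
  have h0 : 0 ≤ ∏ j, x j := Finset.prod_nonneg fun j _ => hx.1 j
  have h1 : ∏ j, x j ≤ 1 := Finset.prod_le_one (fun j _ => hx.1 j) fun j _ => hx.2 j
  have hN : (0 : ℝ) ≤ N := Nat.cast_nonneg N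
  have hc : (((Finset.range N).filter (fun n => ∀ j, 0 ≤ y n j ∧ y n j < x j)).card : ℝ) ≤ N := by
    exact_mod_cast (Finset.card_filter_le _ _).trans (Finset.card_range N).le
  have hc0 : (0 : ℝ) ≤ (((Finset.range N).filter
      (fun n => ∀ j, 0 ≤ y n j ∧ y n j < x j)).card : ℝ) := Nat.cast_nonneg _
  have h2 : (N : ℝ) * ∏ j, x j ≤ N := mul_le_of_le_one_right hN h1
  have h3 : 0 ≤ (N : ℝ) * ∏ j, x j := mul_nonneg hN h0
  have e : localDiscrepancy y x N = (((Finset.range N).filter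
      (fun n => ∀ j, 0 ≤ y n j ∧ y n j < x j)).card : ℝ) - (N : ℝ) * ∏ j, x j := by
    unfold localDiscrepancy
    congr!
  rw [e, abs_le]
  constructor <;> linarith

/-- The (unnormalized) star discrepancy `D_N^* = sup_{x ∈ [0,1]^s} |D(x, N)|`. -/
def starDiscrepancy {s : ℕ} (y : ℕ → Fin s → ℝ) (N : ℕ) : ℝ :=
  ⨆ x : Set.Icc (0 : Fin s → ℝ) 1, |localDiscrepancy y x N|

/-! ### The unit ball and its Haar measure -/

/-- The compact group of the Laurent series `∑_{k ≥ 1} a_k x^{-k}` over `ℤ_q`, that is of the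
`g ∈ ℤ_q((x⁻¹))` with `g = {g}`. -/
def unitBall (q : ℕ) : AddSubgroup (LaurentSeries (ZMod q)) where
  carrier := {g | ∀ k : ℤ, k < 1 → g.coeff k = 0}
  zero_mem' := fun k _ => by simp
  add_mem' := fun {a b} ha hb k hk => by simp [ha k hk, hb k hk]
  neg_mem' := fun {a} ha k hk => by simp [ha k hk]

/-- The series `∑_{k ≥ 1} a_{k-1} x^{-k}` with prescribed coefficients. -/
def ofCoeffs {q : ℕ} (a : ℕ → ZMod q) : unitBall q :=
  ⟨HahnSeries.ofSuppBddBelow (fun k : ℤ => if 1 ≤ k then a (k - 1).toNat else 0)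
    ⟨1, fun k hk => by
      by_contra h
      exact hk (if_neg h)⟩,
    fun k hk => if_neg (not_le.mpr hk)⟩

theorem ofCoeffs_surjective {q : ℕ} : Function.Surjective (ofCoeffs (q := q)) := by
  intro g
  refine ⟨fun n => (g : LaurentSeries (ZMod q)).coeff ((n : ℤ) + 1), ?_⟩
  apply Subtype.ext
  apply HahnSeries.ext
  funext k
  change (if 1 ≤ k then (g : LaurentSeries (ZMod q)).coeff (((k - 1).toNat : ℤ) + 1) else 0) = _
  split_ifs with h
  · congr 1
    omega
  · exact (g.2 k (not_le.mp h)).symm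

theorem continuous_ofCoeffs {q : ℕ} [Fact q.Prime] : Continuous (ofCoeffs (q := q)) := by
  refine Continuous.subtype_mk (continuous_iff_continuousAt.mpr fun a => ?_) _
  intro U hU
  obtain ⟨γ, hγ⟩ := Valued.mem_nhds.mp hU
  have hne : MonoidWithZeroHom.ValueGroup₀.embedding γ.1 ≠ 0 := by
    simp
  set δ := MonoidWithZeroHom.ValueGroup₀.embedding γ.1 with hδ
  obtain ⟨D, hD⟩ : ∃ D : ℤ, WithZero.exp (-D) < δ := by
    refine ⟨1 - WithZero.log δ, ?_⟩
    rw [← WithZero.lt_log_iff_exp_lt hne]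
    omega
  have hev : ∀ᶠ b in nhds a, ∀ i ∈ Finset.range D.toNat, b i = a i := by
    rw [Filter.eventually_all_finset]
    intro i _
    exact (continuous_apply i).continuousAt.eventually
      ((isOpen_discrete ({a i} : Set (ZMod q))).mem_nhds rfl)
  rw [Filter.mem_map]
  filter_upwards [hev] with b hb
  apply hγ
  rw [Set.mem_ofPred_eq, Valuation.restrict_lt_iff_lt_embedding]
  refine lt_of_le_of_lt ?_ hD
  rw [LaurentSeries.valuation_le_iff_coeff_lt_eq_zero]
  intro n hn
  rw [HahnSeries.coeff_sub]
  change (if 1 ≤ n then b (n - 1).toNat else 0) - (if 1 ≤ n then a (n - 1).toNat else 0) = 0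
  split_ifs with h
  · rw [hb _ (by rw [Finset.mem_range]; omega), sub_self]
  · exact sub_self 0

instance (q : ℕ) [Fact q.Prime] : CompactSpace (unitBall q) := by
  rw [← isCompact_univ_iff, ← ofCoeffs_surjective.range_eq]
  exact isCompact_range continuous_ofCoeffs

instance (q : ℕ) [Fact q.Prime] : MeasurableSpace (unitBall q) := borel _

instance (q : ℕ) [Fact q.Prime] : BorelSpace (unitBall q) := ⟨rfl⟩

/-- The normalized Haar measure `μ` on the unit ball: the translation invariant regular Borel
measure giving mass `1` to the whole group. -/
def haar (q : ℕ) [Fact q.Prime] : Measure (unitBall q) :=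
  Measure.addHaarMeasure ⊤

/-- The `s`-fold product measure `μ_s`. -/
def haarPi (q s : ℕ) [Fact q.Prime] : Measure (Fin s → unitBall q) :=
  Measure.pi fun _ => haar q

end

end DigitalKronecker

/-! The theorem follows by finding linear forms `k · f = ∑ k_j f_j`, with polynomial coefficients
`k_j` of degree `m_j`, that are unusually small modulo polynomials, and by turning each of them into
one bad box.

From small form to discrepancy (`le_starDiscrepancy_of_linForm`): let `M = ∑ m_j + D` and let the
coefficients of `x⁻¹, …, x⁻ᴹ` in `k · f` vanish. For `n < q^M` the coefficient of `x⁻¹` in `n(x) (k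
· f)` is then zero, which is a linear relation among the first `m_j + 1` digits of the coordinates
of the `n`-th point. In a suitable corner box this relation kills one more digit, so a fixed
fraction of the box, of volume about `q^(-∑ m_j)`, contains no point with `n < q^M`. The discrepancy
at `N = q^M` is thus at least `q^D / (4 q^s)`.

Existence of small forms: on the scale `m_j ≈ q^i` take `D = s i + log_q i`. Then `q^D` has the
order of `(log N)^s log log N`. A nonzero form is this small with probability `q^(-∑ m_j - D)`.
There are about `q^(is)` degree vectors, each contributing mass about `q^(-D)`, so a scale has total
mass of order at least `1 / i`, and the sum over `i` diverges. A second-moment Borel–Cantelli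
argument (`ae_infinite_of_pairwise`) gives infinitely many scales once the events are pairwise
non-positively correlated.

For `s ≥ 2` non-parallel forms are exactly independent (`haarPi_real_smallForm_inter`), and
primitive vectors supply enough of them. For `s = 1` all forms are parallel; instead the
denominators of continued fraction convergents are used, whose degrees form a renewal process
(`haarPi_real_inter_convDegree_eq`). -/

namespace DigitalKronecker

noncomputable section

open Polynomial

/-! ### Polynomials inside the field of Laurent series -/

/-- The embedding of `ℤ_q[x]` into `ℤ_q((x⁻¹))` as a ring homomorphism. -/
def polyHom (q : ℕ) : (ZMod q)[X] →+* LaurentSeries (ZMod q) :=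
  Polynomial.eval₂RingHom HahnSeries.C (HahnSeries.single (-1 : ℤ) (1 : ZMod q))

theorem polyToLaurent_eq {q : ℕ} (p : (ZMod q)[X]) : polyToLaurent q p = polyHom q p := rfl

theorem coeff_polyHom_monomial_mul {q : ℕ} (i : ℕ) (a : ZMod q) (g : LaurentSeries (ZMod q))
    (c : ℤ) : (polyHom q (monomial i a) * g).coeff c = a * g.coeff (c + i) := by
  have h : polyHom q (monomial i a) = HahnSeries.single (-(i : ℤ)) a := by
    simp [polyHom, HahnSeries.single_pow, HahnSeries.C_apply, HahnSeries.single_mul_single]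
  rw [h, HahnSeries.coeff_single_mul, sub_neg_eq_add]

theorem coeff_polyHom_mul {q : ℕ} (p : (ZMod q)[X]) (g : LaurentSeries (ZMod q)) (c : ℤ) :
    (polyHom q p * g).coeff c = p.sum fun i a => a * g.coeff (c + i) := by
  induction p using Polynomial.induction_on' with
  | add p r hp hr =>
    rw [map_add, add_mul, HahnSeries.coeff_add, hp, hr, Polynomial.sum_add_index]
    · simp
    · intro i a b
      ring
  | monomial i a => rw [coeff_polyHom_monomial_mul, Polynomial.sum_monomial_index _ _ (by simp)]

theorem coeff_polyHom_mul_range {q : ℕ} (p : (ZMod q)[X]) (g : LaurentSeries (ZMod q)) (c : ℤ)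
    {n : ℕ} (hn : p.natDegree < n) :
    (polyHom q p * g).coeff c = ∑ i ∈ Finset.range n, p.coeff i * g.coeff (c + i) := by
  rw [coeff_polyHom_mul, Polynomial.sum_over_range' _ (by simp) n hn]

theorem coeff_polyHom {q : ℕ} (p : (ZMod q)[X]) (c : ℤ) :
    (polyHom q p).coeff c = if c ≤ 0 then p.coeff (-c).toNat else 0 := by
  have h := coeff_polyHom_mul_range p 1 c
    (n := p.natDegree + 1 + (-c).toNat) (by omega)
  rw [mul_one] at h
  rw [h]
  simp only [HahnSeries.coeff_one, mul_ite, mul_one, mul_zero]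
  split_ifs with hc
  · rw [Finset.sum_eq_single (-c).toNat]
    · rw [if_pos (by omega)]
    · intro i _ hi
      rw [if_neg (by omega)]
    · intro hi
      exact absurd (Finset.mem_range.mpr (by omega)) hi
  · exact Finset.sum_eq_zero fun i _ => if_neg (by omega)

theorem coeff_polyHom_of_pos {q : ℕ} (p : (ZMod q)[X]) {c : ℤ} (hc : 0 < c) :
    (polyHom q p).coeff c = 0 := by
  rw [coeff_polyHom, if_neg (by omega)]

theorem coeff_polyHom_neg {q : ℕ} (p : (ZMod q)[X]) (i : ℕ) :
    (polyHom q p).coeff (-(i : ℤ)) = p.coeff i := by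
  rw [coeff_polyHom, if_pos (by omega)]
  simp

theorem eq_zero_of_coeff_polyHom {q : ℕ} {p : (ZMod q)[X]}
    (h : ∀ c : ℤ, c ≤ 0 → (polyHom q p).coeff c = 0) : p = 0 := by
  ext i
  rw [← coeff_polyHom_neg, h _ (by omega), coeff_zero]

/-- Multiplying by a polynomial of degree at most `d` costs at most `d` vanishing coefficients. -/
theorem coeff_polyHom_mul_eq_zero {q : ℕ} {p : (ZMod q)[X]} {g : LaurentSeries (ZMod q)} {n : ℤ}
    {d : ℕ} (hp : p.natDegree ≤ d) (hg : ∀ c ≤ n, g.coeff c = 0) {c : ℤ} (hc : c + d ≤ n) :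
    (polyHom q p * g).coeff c = 0 := by
  rw [coeff_polyHom_mul_range p g c (Nat.lt_succ_of_le hp)]
  refine Finset.sum_eq_zero fun i hi => ?_
  rw [hg _ (by have := Finset.mem_range.mp hi; omega), mul_zero]

/-- Orders are additive: the leading term of `p` times the lowest term of `g` cannot cancel, so
division by `p` gains `natDegree p` vanishing coefficients. -/
theorem coeff_eq_zero_of_polyHom_mul {q : ℕ} [Fact q.Prime] {p : (ZMod q)[X]} (hp : p ≠ 0)
    {g : LaurentSeries (ZMod q)} {n : ℤ} (h : ∀ c ≤ n, (polyHom q p * g).coeff c = 0) {c : ℤ}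
    (hc : c ≤ n + p.natDegree) : g.coeff c = 0 := by
  by_contra hne
  have hg : g ≠ 0 := by
    rintro rfl
    simp at hne
  have hord : g.order ≤ c := HahnSeries.order_le_of_coeff_ne_zero hne
  have h1 := h (g.order - p.natDegree) (by omega)
  rw [coeff_polyHom_mul_range p g _ (Nat.lt_succ_self _), Finset.sum_range_succ,
    Finset.sum_eq_zero, zero_add, sub_add_cancel] at h1
  · rcases mul_eq_zero.mp h1 with h2 | h2
    · exact hp (leadingCoeff_eq_zero.mp h2)
    · exact hg (HahnSeries.coeff_order_eq_zero.mp h2)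
  · intro i hi
    rw [HahnSeries.coeff_eq_zero_of_lt_order (by have := Finset.mem_range.mp hi; omega), mul_zero]

/-- Testing on the single monomial with exponent `c + i`, which lies in the unit ball because `1 ≤ c
+ i`, isolates `u.coeff i`. -/
theorem coeff_eq_zero_of_forall_unitBall {q : ℕ} {u : (ZMod q)[X]} {c : ℤ}
    (h : ∀ g : unitBall q, (polyHom q u * g).coeff c = 0) {i : ℕ} (hi : 1 ≤ c + i) :
    u.coeff i = 0 := by
  have h1 := h ⟨HahnSeries.single (c + i) 1, fun k hk => HahnSeries.coeff_single_of_ne (by omega)⟩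
  rw [HahnSeries.coeff_mul_single, mul_one, show c - (c + i) = -(i : ℤ) by ring,
    coeff_polyHom_neg] at h1
  exact h1

/-! ### The digits of the Kronecker sequence -/

theorem natDegree_digitPoly_lt {q n M : ℕ} (hq : 1 < q) (hM : 0 < M) (hn : n < q ^ M) :
    (digitPoly q n).natDegree < M := by
  unfold digitPoly
  refine lt_of_le_of_lt (natDegree_sum_le_of_forall_le _ _ (n := M - 1) fun i hi => ?_) (by omega)
  refine (natDegree_monomial_le _).trans ?_
  have h1 := Finset.mem_range.mp hi
  have h2 : (Nat.digits q n).length ≤ M := (Nat.digits_length_le_iff hq _).mpr hn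
  omega

theorem coeff_fracPart {q : ℕ} (g : LaurentSeries (ZMod q)) {k : ℤ} (hk : 1 ≤ k) :
    (fracPart g).coeff k = g.coeff k := if_pos hk

section Eval

variable {q : ℕ} [Fact q.Prime] (g : LaurentSeries (ZMod q))

theorem digit_term_le (k : ℕ) :
    ((g.coeff ((k : ℤ) + 1)).val : ℝ) / (q : ℝ) ^ (k + 1) ≤ ((q : ℝ) - 1) / q * (1 / q) ^ k := by
  have hq : 0 < (q : ℝ) := by exact_mod_cast (Fact.out : q.Prime).pos
  have h1 : ((g.coeff ((k : ℤ) + 1)).val : ℝ) ≤ q - 1 := by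
    have := ZMod.val_lt (g.coeff ((k : ℤ) + 1))
    have : ((g.coeff ((k : ℤ) + 1)).val : ℝ) + 1 ≤ q := by exact_mod_cast this
    linarith
  rw [show ((q : ℝ) - 1) / q * (1 / q) ^ k = (q - 1) / q ^ (k + 1) by
    rw [one_div_pow, pow_succ]
    field_simp]
  gcongr

theorem summable_digit_bound : Summable fun k : ℕ => ((q : ℝ) - 1) / q * (1 / q) ^ k := by
  have hq : 1 < (q : ℝ) := by exact_mod_cast (Fact.out : q.Prime).one_lt
  exact (summable_geometric_of_lt_one (by positivity) (by rw [div_lt_one] <;> linarith)).mul_left _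

theorem summable_digits :
    Summable fun k : ℕ => ((g.coeff ((k : ℤ) + 1)).val : ℝ) / (q : ℝ) ^ (k + 1) :=
  Summable.of_nonneg_of_le (fun _ => by positivity) (digit_term_le g) summable_digit_bound

theorem digit_le_evalAtBase (k : ℕ) :
    ((g.coeff ((k : ℤ) + 1)).val : ℝ) ≤ evalAtBase g * (q : ℝ) ^ (k + 1) := by
  have hq : 0 < (q : ℝ) := by exact_mod_cast (Fact.out : q.Prime).pos
  rw [← div_le_iff₀ (by positivity)]
  exact (summable_digits g).le_tsum k fun _ _ => by positivity

theorem coeff_eq_zero_of_evalAtBase_lt {a : ℕ} (h : evalAtBase g < ((q : ℝ) ^ a)⁻¹) {k : ℕ}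
    (hk : k < a) : g.coeff ((k : ℤ) + 1) = 0 := by
  have hq : 1 < (q : ℝ) := by exact_mod_cast (Fact.out : q.Prime).one_lt
  have h1 : ((g.coeff ((k : ℤ) + 1)).val : ℝ) < 1 := by
    refine (digit_le_evalAtBase g k).trans_lt ?_
    rw [← lt_div_iff₀ (by positivity), one_div]
    refine h.trans_le (inv_anti₀ (by positivity) (pow_le_pow_right₀ hq.le hk))
  have h2 : (g.coeff ((k : ℤ) + 1)).val = 0 := by
    have : (g.coeff ((k : ℤ) + 1)).val < 1 := by exact_mod_cast h1
    omega
  exact (ZMod.val_eq_zero _).mp h2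

/-- Equality is possible, when all later digits are `q - 1`; the strict inequality of a half-open
box therefore needs a little extra room. -/
theorem evalAtBase_le_of_coeff_eq_zero {a : ℕ} (h : ∀ k < a, g.coeff ((k : ℤ) + 1) = 0) :
    evalAtBase g ≤ ((q : ℝ) ^ a)⁻¹ := by
  have hq : 1 < (q : ℝ) := by exact_mod_cast (Fact.out : q.Prime).one_lt
  unfold evalAtBase
  rw [← (summable_digits g).sum_add_tsum_nat_add a, Finset.sum_eq_zero, zero_add]
  · have hs := summable_digit_bound (q := q)
    have hs' := (summable_nat_add_iff a).mpr hs
    refine (Summable.tsum_le_tsum (fun k => digit_term_le g (k + a))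
      ((summable_nat_add_iff a).mpr (summable_digits g)) hs').trans (le_of_eq ?_)
    simp_rw [pow_add]
    rw [tsum_mul_left, tsum_mul_right, tsum_geometric_of_lt_one (by positivity)
      (by rw [div_lt_one] <;> linarith)]
    have : (q : ℝ) - 1 ≠ 0 := by linarith
    rw [one_div_pow]
    field_simp
  · intro k hk
    rw [h k (Finset.mem_range.mp hk)]
    simp

end Eval

/-! ### A lower bound for the discrepancy from one small linear form -/

theorem abs_localDiscrepancy_le_starDiscrepancy {s : ℕ} (y : ℕ → Fin s → ℝ) {x : Fin s → ℝ}
    (hx : x ∈ Set.Icc (0 : Fin s → ℝ) 1) (N : ℕ) :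
    |localDiscrepancy y x N| ≤ starDiscrepancy y N :=
  le_ciSup (f := fun x : Set.Icc (0 : Fin s → ℝ) 1 => |localDiscrepancy y x N|)
    ⟨N, by rintro _ ⟨x, rfl⟩; exact abs_localDiscrepancy_le y x x.2 N⟩ ⟨x, hx⟩

/-- Two corner boxes with the same points but different volumes force a large discrepancy. -/
theorem volume_sub_le_starDiscrepancy {s : ℕ} (y : ℕ → Fin s → ℝ) {x x' : Fin s → ℝ}
    (hx : x ∈ Set.Icc (0 : Fin s → ℝ) 1) (hx' : x' ∈ Set.Icc (0 : Fin s → ℝ) 1) (N : ℕ)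
    (h : ∀ n < N, (∀ j, 0 ≤ y n j ∧ y n j < x j) ↔ ∀ j, 0 ≤ y n j ∧ y n j < x' j) :
    N * (∏ j, x j - ∏ j, x' j) ≤ 2 * starDiscrepancy y N := by
  classical
  have h1 := abs_le.mp (abs_localDiscrepancy_le_starDiscrepancy y hx N)
  have h2 := abs_le.mp (abs_localDiscrepancy_le_starDiscrepancy y hx' N)
  unfold localDiscrepancy at h1 h2
  rw [Finset.filter_congr (q := fun n => ∀ j, 0 ≤ y n j ∧ y n j < x' j)
    fun n hn => h n (Finset.mem_range.mp hn)] at h1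
  linarith [h1.1, h2.2]

/-- The linear form `k · f` with polynomial coefficients. -/
def linForm {q s : ℕ} (k : Fin s → (ZMod q)[X]) (f : Fin s → LaurentSeries (ZMod q)) :
    LaurentSeries (ZMod q) :=
  ∑ j, polyHom q (k j) * f j

/-- The coefficient of `x⁻¹` in `p (k · f)` is computed in two ways: it vanishes by smallness of `k
· f`, and it expands into a relation between the leading digits of the products `p f_j`. -/
theorem sum_coeff_eq_zero_of_linForm {q s : ℕ} {k : Fin s → (ZMod q)[X]}
    {f : Fin s → unitBall q} {M : ℕ}
    (hf : ∀ c < M, (linForm k fun j => (f j : LaurentSeries (ZMod q))).coeff ((c : ℤ) + 1) = 0)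
    {p : (ZMod q)[X]} (hp : p.natDegree < M) :
    ∑ j, ∑ i ∈ Finset.range ((k j).natDegree + 1),
      (k j).coeff i * (polyHom q p * f j).coeff ((i : ℤ) + 1) = 0 := by
  have h1 : (polyHom q p * linForm k fun j => (f j : LaurentSeries (ZMod q))).coeff 1 = 0 := by
    rw [coeff_polyHom_mul_range p _ 1 hp]
    refine Finset.sum_eq_zero fun i hi => ?_
    rw [add_comm (1 : ℤ), hf i (Finset.mem_range.mp hi), mul_zero]
  rw [linForm, Finset.mul_sum, HahnSeries.coeff_sum] at h1
  rw [← h1]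
  refine Finset.sum_congr rfl fun j _ => ?_
  rw [mul_left_comm, coeff_polyHom_mul_range (k j) _ 1 (Nat.lt_succ_self _)]
  simp_rw [add_comm (1 : ℤ)]

/-- Two corner boxes differing only in the side `j₀` contain the same points, because the digit
relation excludes the strip between them. -/
theorem le_starDiscrepancy_of_linForm {q : ℕ} [Fact q.Prime] {s : ℕ} {k : Fin s → (ZMod q)[X]}
    {f : Fin s → unitBall q} {D : ℕ} (hk : ∃ j, k j ≠ 0) (hD : 0 < ∑ j, (k j).natDegree + D)
    (hf : ∀ c < ∑ j, (k j).natDegree + D,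
      (linForm k fun j => (f j : LaurentSeries (ZMod q))).coeff ((c : ℤ) + 1) = 0) :
    (q : ℝ) ^ D / (4 * q ^ s) ≤ starDiscrepancy
      (kroneckerSeq fun j => (f j : LaurentSeries (ZMod q))) (q ^ (∑ j, (k j).natDegree + D)) := by
  classical
  obtain ⟨j₀, hj₀⟩ := hk
  have hq1 := (Fact.out : q.Prime).one_lt
  have hq2 : (2 : ℝ) ≤ q := by exact_mod_cast (Fact.out : q.Prime).two_le
  set a : Fin s → ℕ := fun j => (k j).natDegree + 1 with ha
  have hpos : ∀ j, 0 < ((q : ℝ) ^ a j)⁻¹ := fun j => by positivity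
  have hle : ∀ j, ((q : ℝ) ^ a j)⁻¹ ≤ 1 / 2 := fun j => by
    rw [one_div]
    refine inv_anti₀ (by positivity) (hq2.trans ?_)
    calc (q : ℝ) = q ^ 1 := (pow_one _).symm
      _ ≤ q ^ a j := pow_le_pow_right₀ (by linarith) (by simp [ha])
  have key : ∀ t : ℝ, 0 ≤ t → t ≤ 2 →
      (fun j => (if j = j₀ then t else 1) * ((q : ℝ) ^ a j)⁻¹) ∈ Set.Icc (0 : Fin s → ℝ) 1 := by
    intro t ht0 ht2
    constructor <;> intro j <;> have h1 := hpos j <;> have h2 := hle j <;>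
      simp only [Pi.zero_apply, Pi.one_apply] <;> split_ifs
    · positivity
    · positivity
    · nlinarith
    · linarith
  have hvol : ∀ t : ℝ, ∏ j, (if j = j₀ then t else 1) * ((q : ℝ) ^ a j)⁻¹
      = t * ((q : ℝ) ^ (∑ j, (k j).natDegree + s))⁻¹ := by
    intro t
    rw [Finset.prod_mul_distrib, Finset.prod_ite_eq' Finset.univ j₀ fun _ => t,
      if_pos (Finset.mem_univ _), Finset.prod_inv_distrib, Finset.prod_pow_eq_pow_sum]
    simp [ha, Finset.sum_add_distrib]
  -- Side `j₀` is `2 q^(-a)` or `(3/2) q^(-a)`. The factor `3/2` rather than `1` leaves room for a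
  -- coordinate equal to `q^(-a)`.
  have main := volume_sub_le_starDiscrepancy
    (kroneckerSeq fun j => (f j : LaurentSeries (ZMod q)))
    (key 2 (by norm_num) le_rfl) (key (3 / 2) (by norm_num) (by norm_num))
    (q ^ (∑ j, (k j).natDegree + D)) fun n hn => by
      constructor
      · intro h j
        refine ⟨(h j).1, ?_⟩
        by_cases hj : j = j₀
        swap
        · simpa [hj] using (h j).2
        subst hj
        set y : Fin s → LaurentSeries (ZMod q) := fun j =>
          fracPart (polyToLaurent q (digitPoly q n) * (f j : LaurentSeries (ZMod q))) with hy
        have hother : ∀ i ≠ j, ∀ l < a i, (y i).coeff ((l : ℤ) + 1) = 0 := by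
          intro i hi l hl
          refine coeff_eq_zero_of_evalAtBase_lt (a := a i) _ ?_ hl
          have := (h i).2
          rw [if_neg hi, one_mul] at this
          exact this
        -- Since `2 ≤ q`, the wider side is at most `q^(-natDegree)`, so all digits but the last
        -- relevant one vanish.
        have hlow : ∀ l < (k j).natDegree, (y j).coeff ((l : ℤ) + 1) = 0 := by
          intro l hl
          refine coeff_eq_zero_of_evalAtBase_lt (a := (k j).natDegree) _ ?_ hl
          have := (h j).2
          rw [if_pos rfl] at this
          refine lt_of_lt_of_le this ?_
          rw [ha]
          simp only [pow_succ, mul_inv]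
          rw [mul_left_comm]
          refine mul_le_of_le_one_right (by positivity) ?_
          rw [← div_eq_mul_inv, div_le_one] <;> linarith
        -- In the relation only the leading coefficient of `k j` times the last digit survives, so
        -- this digit vanishes too.
        have hrel := sum_coeff_eq_zero_of_linForm hf (natDegree_digitPoly_lt hq1 hD hn)
        rw [Finset.sum_eq_single j, Finset.sum_range_succ, Finset.sum_eq_zero, zero_add] at hrel
        · have htop : (y j).coeff (((k j).natDegree : ℤ) + 1) = 0 := by
            rw [hy]
            simp only
            rw [coeff_fracPart _ (by omega), polyToLaurent_eq]
            exact (mul_eq_zero.mp hrel).resolve_left (mt leadingCoeff_eq_zero.mp hj₀)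
          have hall : evalAtBase (y j) ≤ ((q : ℝ) ^ a j)⁻¹ := by
            refine evalAtBase_le_of_coeff_eq_zero _ fun l hl => ?_
            rcases Nat.lt_succ_iff_lt_or_eq.mp hl with hl | rfl
            · exact hlow l hl
            · exact htop
          rw [if_pos rfl]
          refine lt_of_le_of_lt hall ?_
          linarith [hpos j]
        · intro l hl
          have := hlow l (Finset.mem_range.mp hl)
          rw [hy] at this
          simp only at this
          rw [coeff_fracPart _ (by omega), polyToLaurent_eq] at this
          rw [this, mul_zero]
        · intro i _ hi
          refine Finset.sum_eq_zero fun l hl => ?_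
          have := hother i hi l (Finset.mem_range.mp hl)
          rw [hy] at this
          simp only at this
          rw [coeff_fracPart _ (by omega), polyToLaurent_eq] at this
          rw [this, mul_zero]
        · exact fun h => absurd (Finset.mem_univ _) h
      · intro h j
        refine ⟨(h j).1, (h j).2.trans_le ?_⟩
        gcongr
        split_ifs <;> norm_num
  rw [hvol, hvol, pow_add _ _ s] at main
  push_cast at main
  rw [pow_add] at main
  have hqm : (0 : ℝ) < (q : ℝ) ^ ∑ j, (k j).natDegree := by positivity
  have hqs : (0 : ℝ) < (q : ℝ) ^ s := by positivity
  have e : (q : ℝ) ^ (∑ j, (k j).natDegree) * q ^ D *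
      (2 * ((q : ℝ) ^ (∑ j, (k j).natDegree) * q ^ s)⁻¹ -
        3 / 2 * ((q : ℝ) ^ (∑ j, (k j).natDegree) * q ^ s)⁻¹) = 2 * ((q : ℝ) ^ D / (4 * q ^ s)) := by
    field_simp
    ring
  rw [e] at main
  linarith

/-! ### Equidistribution of finitely many coefficients -/

theorem measurable_coeff {q : ℕ} [Fact q.Prime] (k : ℤ) :
    Measurable fun g : unitBall q => (g : LaurentSeries (ZMod q)).coeff k := by
  let _ : UniformSpace (ZMod q) := ⊥
  have h := (LaurentSeries.uniformContinuous_coeff (K := ZMod q) k).continuous.comp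
    (continuous_subtype_val (p := fun x => x ∈ unitBall q))
  refine measurable_to_countable' fun v => ?_
  exact (h.isOpen_preimage {v} (isOpen_discrete _)).measurableSet

instance (q : ℕ) [Fact q.Prime] : IsProbabilityMeasure (haar q) :=
  ⟨Measure.addHaarMeasure_self (K₀ := (⊤ : TopologicalSpace.PositiveCompacts (unitBall q)))⟩

instance (q : ℕ) [Fact q.Prime] : (haar q).IsAddLeftInvariant := by
  unfold haar
  infer_instance

instance (q s : ℕ) [Fact q.Prime] : IsProbabilityMeasure (haarPi q s) := by
  unfold haarPi
  infer_instance

instance (q s : ℕ) [Fact q.Prime] : (haarPi q s).IsAddLeftInvariant := by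
  unfold haarPi
  infer_instance

/-- The fibres of a homomorphism onto a finite group have equal mass. -/
theorem measureReal_fiber {G H : Type*} [AddGroup G] [MeasurableSpace G] [MeasurableAdd G]
    (μ : Measure G) [IsProbabilityMeasure μ] [μ.IsAddLeftInvariant] [AddGroup H] [Fintype H]
    (φ : G →+ H) (hφ : Function.Surjective φ) (hm : ∀ v, MeasurableSet (φ ⁻¹' {v})) (v : H) :
    μ.real (φ ⁻¹' {v}) = (Fintype.card H : ℝ)⁻¹ := by
  have heq : ∀ w, μ.real (φ ⁻¹' {w}) = μ.real (φ ⁻¹' {v}) := by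
    intro w
    obtain ⟨g, hg⟩ := hφ (v - w)
    have : φ ⁻¹' {w} = (fun x => g + x) ⁻¹' (φ ⁻¹' {v}) := by
      ext x
      simp only [Set.mem_preimage, Set.mem_singleton_iff, map_add, hg]
      constructor
      · rintro rfl
        simp
      · intro h
        have : v = v - w + w := by simp
        exact add_left_cancel (h.trans this)
    rw [this, measureReal_def, measure_preimage_add, measureReal_def]
  have hsum : ∑ w, μ.real (φ ⁻¹' {w}) = 1 := by
    rw [← measureReal_biUnion_finset]
    · have : ⋃ w ∈ (Finset.univ : Finset H), φ ⁻¹' {w} = Set.univ := by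
        ext x
        simp
      rw [this, probReal_univ]
    · intro a _ b _ hab
      exact Disjoint.preimage _ (by simpa using hab)
    · exact fun w _ => hm w
  rw [Finset.sum_congr rfl fun w _ => heq w, Finset.sum_const, nsmul_eq_mul] at hsum
  exact eq_inv_of_mul_eq_one_right hsum

/-- A homomorphism into `ℤ_q^Λ` is onto if no nonzero functional vanishes on its range. -/
theorem surjective_of_forall_functional {q : ℕ} [Fact q.Prime] {G Λ : Type*} [AddCommGroup G]
    [Fintype Λ] (φ : G →+ (Λ → ZMod q))
    (h : ∀ α : Λ → ZMod q, (∀ g, ∑ l, α l * φ g l = 0) → α = 0) : Function.Surjective φ := by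
  classical
  by_contra hns
  have hlt : AddSubgroup.toZModSubmodule q φ.range < ⊤ := by
    rw [lt_top_iff_ne_top]
    intro htop
    apply hns
    intro v
    have : v ∈ AddSubgroup.toZModSubmodule q φ.range := htop ▸ Submodule.mem_top
    exact this
  -- A proper subspace lies in the kernel of a nonzero functional; its values on the standard basis
  -- serve as `α`.
  obtain ⟨L, hL, hle⟩ := Submodule.exists_le_ker_of_lt_top _ hlt
  have hα := h (fun l => L (Pi.single l 1)) fun g => by
    have h1 : L (φ g) = 0 := hle (show φ g ∈ φ.range from ⟨g, rfl⟩)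
    rw [← h1, LinearMap.pi_apply_eq_sum_univ L (φ g)]
    refine Finset.sum_congr rfl fun l _ => ?_
    rw [smul_eq_mul, mul_comm]
    congr 2
    ext j
    simp [Pi.single_apply, eq_comm]
  apply hL
  ext l
  simpa using congrFun hα l

theorem measurableSet_fiber {q s : ℕ} [Fact q.Prime] {Λ : Type*} [Fintype Λ]
    {φ : (Fin s → unitBall q) → Λ → ZMod q} (hm : ∀ l, Measurable fun f => φ f l)
    (v : Λ → ZMod q) : MeasurableSet {f | φ f = v} :=
  measurableSet_eq_fun (measurable_pi_lambda _ hm) measurable_const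

/-- The joint distribution of independent coefficient functionals is uniform. -/
theorem haarPi_real_fiber {q s : ℕ} [Fact q.Prime] {Λ : Type*} [Fintype Λ]
    (φ : (Fin s → unitBall q) →+ (Λ → ZMod q)) (hm : ∀ l, Measurable fun f => φ f l)
    (h : ∀ α : Λ → ZMod q, (∀ g, ∑ l, α l * φ g l = 0) → α = 0) (v : Λ → ZMod q) :
    (haarPi q s).real {f | φ f = v} = ((q : ℝ) ^ Fintype.card Λ)⁻¹ := by
  classical
  have := measureReal_fiber (haarPi q s) φ (surjective_of_forall_functional φ h)
    (fun v => measurableSet_fiber hm v) v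
  rw [Fintype.card_fun, ZMod.card, Nat.cast_pow] at this
  exact this

/-- The coefficient of `k · f` at `c`, as a homomorphism in `f`. -/
def linFormCoeff {q s : ℕ} (k : Fin s → (ZMod q)[X]) (c : ℤ) :
    (Fin s → unitBall q) →+ ZMod q where
  toFun f := (linForm k fun j => (f j : LaurentSeries (ZMod q))).coeff c
  map_zero' := by simp [linForm]
  map_add' f g := by simp [linForm, mul_add, Finset.sum_add_distrib]

theorem linFormCoeff_apply {q s : ℕ} (k : Fin s → (ZMod q)[X]) (c : ℤ) (f : Fin s → unitBall q) :
    linFormCoeff k c f = (linForm k fun j => (f j : LaurentSeries (ZMod q))).coeff c := rfl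

theorem measurable_linFormCoeff {q s : ℕ} [Fact q.Prime] (k : Fin s → (ZMod q)[X]) (c : ℤ) :
    Measurable (linFormCoeff k c) := by
  have : (linFormCoeff k c : (Fin s → unitBall q) → ZMod q) = fun f => ∑ j,
      ∑ i ∈ Finset.range ((k j).natDegree + 1),
        (k j).coeff i * (f j : LaurentSeries (ZMod q)).coeff (c + i) := by
    funext f
    rw [linFormCoeff_apply, linForm, HahnSeries.coeff_sum]
    exact Finset.sum_congr rfl fun j _ => coeff_polyHom_mul_range _ _ _ (Nat.lt_succ_self _)
  rw [this]
  refine Finset.measurable_sum _ fun j _ => Finset.measurable_sum _ fun i _ => ?_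
  exact ((measurable_coeff (c + i)).comp (measurable_pi_apply j)).const_mul _

/-- The polynomial with given coefficients. -/
def polyOfFn {q n : ℕ} (α : Fin n → ZMod q) : (ZMod q)[X] :=
  ∑ i : Fin n, monomial (i : ℕ) (α i)

/-- A combination of consecutive coefficients of `k · f` is one coefficient of a multiple. -/
theorem sum_mul_linFormCoeff {q s : ℕ} (k : Fin s → (ZMod q)[X]) (c : ℤ) {n : ℕ}
    (α : Fin n → ZMod q) (f : Fin s → unitBall q) :
    ∑ i, α i * linFormCoeff k (c + (i : ℕ)) f =
      linFormCoeff (fun j => polyOfFn α * k j) c f := by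
  simp only [linFormCoeff_apply, linForm, map_mul, mul_assoc, ← Finset.mul_sum]
  rw [polyOfFn, map_sum, Finset.sum_mul, HahnSeries.coeff_sum]
  exact Finset.sum_congr rfl fun i _ => (coeff_polyHom_monomial_mul _ _ _ _).symm

theorem coeff_polyOfFn {q n : ℕ} (α : Fin n → ZMod q) (i : Fin n) :
    (polyOfFn α).coeff (i : ℕ) = α i := by
  rw [polyOfFn, finsetSum_coeff, Finset.sum_eq_single i]
  · rw [coeff_monomial, if_pos rfl]
  · intro b _ hb
    rw [coeff_monomial, if_neg fun h => hb (Fin.ext h)]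
  · exact fun h => absurd (Finset.mem_univ _) h

theorem eq_zero_of_polyOfFn_eq_zero {q n : ℕ} {α : Fin n → ZMod q}
    (h : polyOfFn α = 0) : α = 0 := by
  ext i
  rw [← coeff_polyOfFn α i, h, coeff_zero, Pi.zero_apply]

/-- If the coefficient of `u · f` at `c` vanishes identically, all `u_j` have small degree. -/
theorem coeff_eq_zero_of_linFormCoeff {q s : ℕ} {u : Fin s → (ZMod q)[X]} {c : ℤ}
    (h : ∀ f, linFormCoeff u c f = 0) (j : Fin s) {i : ℕ} (hi : 1 ≤ c + i) :
    (u j).coeff i = 0 := by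
  classical
  refine coeff_eq_zero_of_forall_unitBall (c := c) (fun g => ?_) hi
  have := h (Pi.single j g)
  rw [linFormCoeff_apply, linForm, Finset.sum_eq_single j] at this
  · simpa using this
  · intro b _ hb
    simp [hb]
  · exact fun h => absurd (Finset.mem_univ _) h

theorem eq_zero_of_linFormCoeff_one {q s : ℕ} {u : Fin s → (ZMod q)[X]}
    (h : ∀ f, linFormCoeff u 1 f = 0) : u = 0 := by
  ext j i
  rw [coeff_eq_zero_of_linFormCoeff h j (by omega)]
  simp

/-- The event that `k · f` is small modulo polynomials. -/
def smallForm {q s : ℕ} (k : Fin s → (ZMod q)[X]) (M : ℕ) : Set (Fin s → unitBall q) :=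
  {f | ∀ c < M, linFormCoeff k ((c : ℤ) + 1) f = 0}

theorem smallForm_eq {q s : ℕ} (k : Fin s → (ZMod q)[X]) (M : ℕ) :
    smallForm k M =
      {f | (AddMonoidHom.pi fun c : Fin M => linFormCoeff k (1 + (c : ℕ))) f = 0} := by
  ext f
  simp [smallForm, funext_iff, Fin.forall_iff, add_comm]

theorem measurableSet_smallForm {q s : ℕ} [Fact q.Prime] (k : Fin s → (ZMod q)[X]) (M : ℕ) :
    MeasurableSet (smallForm k M) := by
  rw [smallForm_eq]
  exact measurableSet_fiber (fun l => measurable_linFormCoeff _ _) _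

/-- The `M` coefficients are independent: a combination `α` of them is one coefficient of `(α k) ·
f`, and if it vanishes identically then `α k = 0`, hence `α = 0`. -/
theorem haarPi_real_smallForm {q s : ℕ} [Fact q.Prime] {k : Fin s → (ZMod q)[X]} (hk : k ≠ 0)
    (M : ℕ) : (haarPi q s).real (smallForm k M) = ((q : ℝ) ^ M)⁻¹ := by
  rw [smallForm_eq, haarPi_real_fiber _ (fun l => measurable_linFormCoeff _ _), Fintype.card_fin]
  intro α hα
  have h0 := eq_zero_of_linFormCoeff_one fun f => (sum_mul_linFormCoeff k 1 α f).symm.trans (hα f)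
  obtain ⟨j, hj⟩ := Function.ne_iff.mp hk
  exact eq_zero_of_polyOfFn_eq_zero ((mul_eq_zero.mp (congrFun h0 j)).resolve_right hj)

/-- Non-parallel linear forms are independent. -/
theorem haarPi_real_smallForm_inter {q s : ℕ} [Fact q.Prime] {k k' : Fin s → (ZMod q)[X]}
    (hk : ∀ a b : (ZMod q)[X], (∀ j, a * k j + b * k' j = 0) → a = 0 ∧ b = 0) (M M' : ℕ) :
    (haarPi q s).real (smallForm k M ∩ smallForm k' M') =
      ((q : ℝ) ^ M)⁻¹ * ((q : ℝ) ^ M')⁻¹ := by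
  have hset : smallForm k M ∩ smallForm k' M' =
      {f | (AddMonoidHom.pi (Sum.elim (fun c : Fin M => linFormCoeff k (1 + (c : ℕ)))
        fun c : Fin M' => linFormCoeff k' (1 + (c : ℕ)))) f = 0} := by
    ext f
    simp [smallForm, funext_iff, Fin.forall_iff, add_comm]
  rw [hset, haarPi_real_fiber, Fintype.card_sum, Fintype.card_fin, Fintype.card_fin, pow_add,
    mul_inv]
  · rintro (l | l) <;> exact measurable_linFormCoeff _ _
  · intro α hα
    have h0 := eq_zero_of_linFormCoeff_one (u := fun j =>
      polyOfFn (fun i => α (Sum.inl i)) * k j +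
        polyOfFn (fun i => α (Sum.inr i)) * k' j) fun f => by
        have h1 := hα f
        rw [Fintype.sum_sum_type] at h1
        simp only [AddMonoidHom.pi_apply, Sum.elim_inl, Sum.elim_inr] at h1
        rw [sum_mul_linFormCoeff k 1 fun i => α (Sum.inl i),
          sum_mul_linFormCoeff k' 1 fun i => α (Sum.inr i)] at h1
        rw [← h1]
        simp only [linFormCoeff_apply, linForm, map_add, add_mul, Finset.sum_add_distrib,
          HahnSeries.coeff_add]
    obtain ⟨ha, hb⟩ := hk _ _ fun j => congrFun h0 j
    ext (i | i)
    · exact congrFun (eq_zero_of_polyOfFn_eq_zero ha) i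
    · exact congrFun (eq_zero_of_polyOfFn_eq_zero hb) i

/-! ### A Borel–Cantelli lemma for negatively correlated events -/

theorem tendsto_sum_div_atTop {c : ℝ} (hc : 0 < c) :
    Filter.Tendsto (fun n => ∑ i ∈ Finset.range n, c / ((i : ℝ) + 1)) Filter.atTop Filter.atTop := by
  have h := Real.tendsto_sum_range_one_div_nat_succ_atTop.const_mul_atTop hc
  refine h.congr fun n => ?_
  rw [Finset.mul_sum]
  exact Finset.sum_congr rfl fun i _ => by ring

/-- Chebyshev's inequality for the number of occurring events. -/
theorem measureReal_count_le {Ω ι : Type*} [MeasurableSpace Ω] (μ : Measure Ω)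
    [IsProbabilityMeasure μ] (J : Finset ι) (E : ι → Set Ω) (hm : ∀ i ∈ J, MeasurableSet (E i))
    (hpair : ∀ i ∈ J, ∀ j ∈ J, i ≠ j → μ.real (E i ∩ E j) ≤ μ.real (E i) * μ.real (E j)) {K : ℝ}
    (hK : K < ∑ i ∈ J, μ.real (E i)) :
    μ.real {ω | ∑ i ∈ J, (E i).indicator 1 ω ≤ K} ≤
      (∑ i ∈ J, μ.real (E i)) / (∑ i ∈ J, μ.real (E i) - K) ^ 2 := by
  classical
  set S := ∑ i ∈ J, μ.real (E i) with hS
  set Z : Ω → ℝ := fun ω => ∑ i ∈ J, (E i).indicator 1 ω with hZ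
  have hint : ∀ i ∈ J, Integrable ((E i).indicator (1 : Ω → ℝ)) μ := fun i hi =>
    (integrable_const (1 : ℝ)).indicator (hm i hi)
  have hEZ : ∫ ω, Z ω ∂μ = S := by
    rw [integral_finsetSum _ hint]
    exact Finset.sum_congr rfl fun i hi => integral_indicator_one (hm i hi)
  have hprod : ∀ i j, (fun ω => (E i).indicator (1 : Ω → ℝ) ω * (E j).indicator 1 ω) =
      (E i ∩ E j).indicator 1 := fun i j => by
    rw [Set.inter_indicator_one]
    rfl
  have hsq : ∀ ω, Z ω ^ 2 = ∑ i ∈ J, ∑ j ∈ J, (E i ∩ E j).indicator (1 : Ω → ℝ) ω := by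
    intro ω
    rw [sq, hZ]
    simp only [Finset.sum_mul_sum]
    exact Finset.sum_congr rfl fun i _ => Finset.sum_congr rfl fun j _ => congrFun (hprod i j) ω
  have hint2 : ∀ i ∈ J, ∀ j ∈ J, Integrable ((E i ∩ E j).indicator (1 : Ω → ℝ)) μ :=
    fun i hi j hj => (integrable_const (1 : ℝ)).indicator ((hm i hi).inter (hm j hj))
  have hintsq : Integrable (fun ω => Z ω ^ 2) μ := by
    simp_rw [hsq]
    exact integrable_finsetSum _ fun i hi => integrable_finsetSum _ fun j hj => hint2 i hi j hj
  have hEsq : ∫ ω, Z ω ^ 2 ∂μ ≤ S ^ 2 + S := by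
    simp_rw [hsq]
    rw [integral_finsetSum _ fun i hi => integrable_finsetSum _ fun j hj => hint2 i hi j hj]
    have : ∀ i ∈ J, ∫ ω, ∑ j ∈ J, (E i ∩ E j).indicator (1 : Ω → ℝ) ω ∂μ ≤
        μ.real (E i) * S + μ.real (E i) := by
      intro i hi
      rw [integral_finsetSum _ fun j hj => hint2 i hi j hj, hS, Finset.mul_sum]
      -- The diagonal terms contribute `S` in total, the off-diagonal ones at most `S ^ 2`; hence
      -- the variance is at most `S`.
      have e : ∑ j ∈ J, (if j = i then μ.real (E i) else 0) = μ.real (E i) := by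
        rw [Finset.sum_ite_eq' J i, if_pos hi]
      refine le_of_le_of_eq ?_ (congrArg (_ + ·) e)
      rw [← Finset.sum_add_distrib]
      refine Finset.sum_le_sum fun j hj => ?_
      rw [integral_indicator_one ((hm i hi).inter (hm j hj))]
      split_ifs with h
      · subst h
        rw [Set.inter_self]
        have := mul_self_nonneg (μ.real (E j))
        linarith
      · rw [add_zero]
        exact hpair i hi j hj (Ne.symm h)
    refine (Finset.sum_le_sum this).trans (le_of_eq ?_)
    rw [Finset.sum_add_distrib, ← Finset.sum_mul, sq]
  have hintZ : Integrable Z μ := integrable_finsetSum _ hint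
  have hvar : ∫ ω, (Z ω - S) ^ 2 ∂μ ≤ S := by
    have : ∀ ω, (Z ω - S) ^ 2 = Z ω ^ 2 - 2 * S * Z ω + S ^ 2 := fun ω => by ring
    simp_rw [this]
    rw [integral_add (f := fun ω => Z ω ^ 2 - 2 * S * Z ω) (hintsq.sub (hintZ.const_mul _))
      (integrable_const _), integral_sub hintsq (hintZ.const_mul _), integral_const_mul, hEZ]
    simp only [integral_const, probReal_univ, one_smul]
    nlinarith
  have hint3 : Integrable (fun ω => (Z ω - S) ^ 2) μ := by
    have : (fun ω => (Z ω - S) ^ 2) = fun ω => Z ω ^ 2 - 2 * S * Z ω + S ^ 2 := by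
      funext ω
      ring
    rw [this]
    exact (hintsq.sub (hintZ.const_mul _)).add (integrable_const _)
  have hmk := mul_meas_ge_le_integral_of_nonneg (μ := μ) (f := fun ω => (Z ω - S) ^ 2)
    (Filter.Eventually.of_forall fun ω => sq_nonneg _) hint3 ((S - K) ^ 2)
  have hpos : 0 < S - K := sub_pos.mpr hK
  rw [le_div_iff₀ (by positivity), mul_comm]
  refine le_trans ?_ (hmk.trans hvar)
  refine mul_le_mul_of_nonneg_left (measureReal_mono fun ω hω => ?_) (by positivity)
  have hω' : Z ω ≤ K := hω
  change (S - K) ^ 2 ≤ (Z ω - S) ^ 2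
  nlinarith

/-- By Chebyshev the number of occurring events is almost surely unbounded. As each block `F i` is
finite, infinitely many blocks must be hit. -/
theorem ae_infinite_of_pairwise {Ω κ : Type*} [MeasurableSpace Ω] (μ : Measure Ω)
    [IsProbabilityMeasure μ] (F : ℕ → Finset κ) (E : ℕ → κ → Set Ω)
    (hm : ∀ i, ∀ k ∈ F i, MeasurableSet (E i k))
    (hpair : ∀ i i' k k', k ∈ F i → k' ∈ F i' → (i, k) ≠ (i', k') →
      μ.real (E i k ∩ E i' k') ≤ μ.real (E i k) * μ.real (E i' k')) {c : ℝ} (hc : 0 < c)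
    (hsum : ∀ i : ℕ, c / ((i : ℝ) + 1) ≤ ∑ k ∈ F i, μ.real (E i k)) :
    ∀ᵐ ω ∂μ, {i | ∃ k ∈ F i, ω ∈ E i k}.Infinite := by
  classical
  set J : ℕ → Finset (Σ _ : ℕ, κ) := fun n => (Finset.range n).sigma F with hJ
  set S : ℕ → ℝ := fun n => ∑ p ∈ J n, μ.real (E p.1 p.2) with hS
  have hSt : Filter.Tendsto S Filter.atTop Filter.atTop := by
    refine Filter.tendsto_atTop_mono (fun n => ?_) (tendsto_sum_div_atTop hc)
    rw [hS]
    simp only [hJ, Finset.sum_sigma]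
    exact Finset.sum_le_sum fun i _ => hsum i
  have hbad : ∀ K : ℕ, μ {ω | ∀ n, ∑ p ∈ J n, (E p.1 p.2).indicator (1 : Ω → ℝ) ω ≤ K} = 0 := by
    intro K
    rw [← measureReal_eq_zero_iff]
    refine le_antisymm ?_ measureReal_nonneg
    have hlim : Filter.Tendsto (fun n => 4 / S n) Filter.atTop (nhds 0) :=
      hSt.const_div_atTop 4
    refine ge_of_tendsto hlim ?_
    -- `S n > 2 K` gives `S n - K > S n / 2`, whence the constant `4`.
    filter_upwards [hSt.eventually_gt_atTop (2 * K)] with n hn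
    have hK0 : (0 : ℝ) ≤ K := Nat.cast_nonneg K
    have h1 := measureReal_count_le μ (J n) (fun p => E p.1 p.2)
      (fun p hp => hm _ _ (Finset.mem_sigma.mp hp).2)
      (fun p hp r hr hne => hpair _ _ _ _ (Finset.mem_sigma.mp hp).2 (Finset.mem_sigma.mp hr).2
        fun h => hne (by
          obtain ⟨a, b⟩ := p
          obtain ⟨a', b'⟩ := r
          simp only [Prod.mk.injEq] at h
          obtain ⟨rfl, rfl⟩ := h
          rfl)) (K := K) (by change (K : ℝ) < S n; linarith)
    refine (measureReal_mono (h₂ := measure_ne_top _ _) ?_).trans (h1.trans ?_)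
    · exact fun ω (hω : ∀ n, _) => hω n
    change S n / (S n - K) ^ 2 ≤ 4 / S n
    rw [div_le_div_iff₀ (by nlinarith) (by linarith)]
    nlinarith
  have hall := ae_all_iff.mpr fun K => (measure_eq_zero_iff_ae_notMem.mp (hbad K))
  filter_upwards [hall] with ω hω hfin
  obtain ⟨T, hT⟩ := hfin.exists_finset_coe
  refine hω (∑ i ∈ T, (F i).card) fun n => ?_
  have h1 : ∀ p ∈ J n, (E p.1 p.2).indicator (1 : Ω → ℝ) ω ≤ if p ∈ T.sigma F then 1 else 0 := by
    intro p hp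
    have hpF := (Finset.mem_sigma.mp hp).2
    by_cases h : ω ∈ E p.1 p.2
    · rw [Set.indicator_of_mem h, if_pos]
      · rfl
      · refine Finset.mem_sigma.mpr ⟨?_, hpF⟩
        rw [← Finset.mem_coe, hT]
        exact ⟨p.2, hpF, h⟩
    · rw [Set.indicator_of_notMem h]
      split_ifs <;> norm_num
  refine (Finset.sum_le_sum h1).trans ?_
  rw [Finset.sum_ite_mem, Finset.sum_const, nsmul_eq_mul, mul_one, ← Finset.card_sigma]
  exact_mod_cast Finset.card_le_card Finset.inter_subset_right

/-! ### Convergents -/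

/-- `r = (P, Q)` is a reduced fraction with monic denominator of degree at most `n` such that
`Q g - P = O(x^{-n-1})`. -/
def IsConvergent {q : ℕ} (n : ℕ) (r : (ZMod q)[X] × (ZMod q)[X]) (g : LaurentSeries (ZMod q)) :
    Prop :=
  r.2.Monic ∧ IsCoprime r.1 r.2 ∧ r.2.natDegree ≤ n ∧
    ∀ c ≤ (n : ℤ), (polyHom q r.2 * g - polyHom q r.1).coeff c = 0

theorem eq_of_monic_of_isCoprime_of_mul_eq {q : ℕ} [Fact q.Prime] {P Q P' Q' : (ZMod q)[X]}
    (hQ : Q.Monic) (hQ' : Q'.Monic) (h : IsCoprime P Q) (h' : IsCoprime P' Q')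
    (e : Q * P' = Q' * P) : P = P' ∧ Q = Q' := by
  have h1 : Q ∣ Q' := h.symm.dvd_of_dvd_mul_right (Dvd.intro _ e)
  have h2 : Q' ∣ Q := h'.symm.dvd_of_dvd_mul_right (Dvd.intro _ e.symm)
  have hQQ : Q = Q' := eq_of_monic_of_associated hQ hQ' (associated_of_dvd_dvd h1 h2)
  subst hQQ
  exact ⟨(mul_left_cancel₀ hQ.ne_zero e).symm, rfl⟩

/-- The cross difference `Q P' - Q' P` is a polynomial all of whose coefficients at exponents `c ≤
0` vanish, so the two reduced fractions agree. -/
theorem IsConvergent.eq {q : ℕ} [Fact q.Prime] {n : ℕ} {r r' : (ZMod q)[X] × (ZMod q)[X]}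
    {g : LaurentSeries (ZMod q)} (h : IsConvergent n r g) (h' : IsConvergent n r' g) : r = r' := by
  have h0 : r.2 * r'.1 - r'.2 * r.1 = 0 := by
    refine eq_zero_of_coeff_polyHom fun c hc => ?_
    have e : polyHom q (r.2 * r'.1 - r'.2 * r.1) =
        polyHom q r'.2 * (polyHom q r.2 * g - polyHom q r.1) -
          polyHom q r.2 * (polyHom q r'.2 * g - polyHom q r'.1) := by
      simp only [map_sub, map_mul]
      ring
    rw [e, HahnSeries.coeff_sub, coeff_polyHom_mul_eq_zero h'.2.2.1 h.2.2.2 (by omega),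
      coeff_polyHom_mul_eq_zero h.2.2.1 h'.2.2.2 (by omega), sub_zero]
  have := eq_of_monic_of_isCoprime_of_mul_eq h.1 h'.1 h.2.1 h'.2.1 (sub_eq_zero.mp h0)
  exact Prod.ext this.1 this.2

theorem IsConvergent.mono {q : ℕ} {n m : ℕ} {r : (ZMod q)[X] × (ZMod q)[X]}
    {g : LaurentSeries (ZMod q)} (h : IsConvergent n r g) (hr : r.2.natDegree ≤ m) (hm : m ≤ n) :
    IsConvergent m r g :=
  ⟨h.1, h.2.1, hr, fun c hc => h.2.2.2 c (by omega)⟩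

theorem natDegree_polyOfFn_le {q n : ℕ} (α : Fin (n + 1) → ZMod q) :
    (polyOfFn α).natDegree ≤ n :=
  natDegree_sum_le_of_forall_le _ _ fun i _ => (natDegree_monomial_le _).trans (by omega)

/-- There are `n` homogeneous linear equations for the `n + 1` coefficients of `Q`. -/
theorem exists_polyHom_mul_coeff_eq_zero {q : ℕ} [Fact q.Prime] (n : ℕ)
    (g : LaurentSeries (ZMod q)) : ∃ Q : (ZMod q)[X], Q ≠ 0 ∧ Q.natDegree ≤ n ∧
      ∀ c : ℤ, 1 ≤ c → c ≤ n → (polyHom q Q * g).coeff c = 0 := by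
  have hker := LinearMap.ker_ne_bot_of_finrank_lt (f := Matrix.mulVecLin
    (Matrix.of fun (c : Fin n) (l : Fin (n + 1)) => g.coeff ((c : ℕ) + 1 + (l : ℕ) : ℤ)))
    (by simp)
  obtain ⟨a, ha, ha0⟩ := (Submodule.ne_bot_iff _).mp hker
  refine ⟨polyOfFn a, fun h => ha0 (eq_zero_of_polyOfFn_eq_zero h), natDegree_polyOfFn_le a, ?_⟩
  intro c hc1 hcn
  have h1 := congrFun (LinearMap.mem_ker.mp ha) ⟨(c - 1).toNat, by omega⟩
  simp only [Matrix.mulVecLin_apply, Matrix.mulVec, dotProduct, Matrix.of_apply,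
    Pi.zero_apply] at h1
  rw [polyOfFn, map_sum, Finset.sum_mul, HahnSeries.coeff_sum, ← h1]
  refine Finset.sum_congr rfl fun l _ => ?_
  rw [coeff_polyHom_monomial_mul, mul_comm]
  congr 2
  omega

theorem exists_polyHom_mul_sub_coeff_eq_zero {q : ℕ} [Fact q.Prime] (n : ℕ) (g : unitBall q) :
    ∃ P Q : (ZMod q)[X], Q ≠ 0 ∧ Q.natDegree ≤ n ∧ ∀ c ≤ (n : ℤ),
      (polyHom q Q * (g : LaurentSeries (ZMod q)) - polyHom q P).coeff c = 0 := by
  obtain ⟨Q, hQ0, hQn, hQ⟩ := exists_polyHom_mul_coeff_eq_zero n (g : LaurentSeries (ZMod q))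
  refine ⟨polyOfFn fun i : Fin (n + 1) =>
    (polyHom q Q * (g : LaurentSeries (ZMod q))).coeff (-((i : ℕ) : ℤ)), Q, hQ0, hQn, ?_⟩
  intro c hc
  rw [HahnSeries.coeff_sub, sub_eq_zero]
  rcases lt_or_ge 0 c with h | h
  · rw [coeff_polyHom_of_pos _ h, hQ c (by omega) hc]
  · obtain ⟨i, rfl⟩ : ∃ i : ℕ, c = -(i : ℤ) := ⟨(-c).toNat, by omega⟩
    rw [coeff_polyHom_neg]
    rcases Nat.lt_or_ge n i with hi | hi
    · rw [coeff_eq_zero_of_natDegree_lt ((natDegree_polyOfFn_le _).trans_lt hi)]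
      exact coeff_polyHom_mul_eq_zero (n := 0) hQn (fun c hc => g.2 c (by omega)) (by omega)
    · exact (coeff_polyOfFn (fun i : Fin (n + 1) =>
        (polyHom q Q * (g : LaurentSeries (ZMod q))).coeff (-((i : ℕ) : ℤ)))
        ⟨i, by omega⟩).symm

theorem exists_monic_isCoprime_mul {K : Type*} [Field K] (P : K[X]) {Q : K[X]} (hQ : Q ≠ 0) :
    ∃ d P' Q' : K[X], Q'.Monic ∧ IsCoprime P' Q' ∧ P = d * P' ∧ Q = d * Q' := by
  classical
  obtain ⟨P₁, hP₁⟩ := gcd_dvd_left P Q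
  obtain ⟨Q₁, hQ₁⟩ := gcd_dvd_right P Q
  have hd0 : gcd P Q ≠ 0 := fun h => hQ ((gcd_eq_zero_iff _ _).mp h).2
  have hcop := isCoprime_div_gcd_div_gcd (p := P) hQ
  generalize gcd P Q = d at *
  subst hP₁ hQ₁
  rw [mul_div_cancel_left₀ _ hd0, mul_div_cancel_left₀ _ hd0] at hcop
  have hl : Q₁.leadingCoeff ≠ 0 := leadingCoeff_ne_zero.mpr (right_ne_zero_of_mul hQ)
  have hu : IsUnit (C Q₁.leadingCoeff⁻¹) := isUnit_C.mpr (inv_ne_zero hl).isUnit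
  have e : ∀ A : K[X], d * A = d * C Q₁.leadingCoeff * (C Q₁.leadingCoeff⁻¹ * A) := by
    intro A
    rw [mul_assoc, ← mul_assoc (C _) (C _), ← C_mul, mul_inv_cancel₀ hl, C_1, one_mul]
  exact ⟨_, _, _, monic_C_mul_of_mul_leadingCoeff_eq_one (inv_mul_cancel₀ hl),
    (isCoprime_mul_unit_left hu _ _).mpr hcop, e _, e _⟩

theorem exists_isConvergent {q : ℕ} [Fact q.Prime] (n : ℕ) (g : unitBall q) :
    ∃ r, IsConvergent n r (g : LaurentSeries (ZMod q)) := by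
  obtain ⟨P, Q, hQ0, hQn, h⟩ := exists_polyHom_mul_sub_coeff_eq_zero n g
  obtain ⟨d, P', Q', hm, hcop, rfl, rfl⟩ := exists_monic_isCoprime_mul P hQ0
  have hd0 := left_ne_zero_of_mul hQ0
  refine ⟨(P', Q'), hm, hcop, ?_, fun c hc => ?_⟩
  · rw [natDegree_mul hd0 hm.ne_zero] at hQn
    change Q'.natDegree ≤ n
    omega
  -- Cancelling the common factor `d` does not spoil the approximation.
  · refine coeff_eq_zero_of_polyHom_mul hd0 (n := n) (fun c hc => ?_) (by omega)
    rw [mul_sub, ← mul_assoc, ← map_mul, ← map_mul]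
    exact h c hc

/-- The convergent of level `n`. -/
def convergent {q : ℕ} [Fact q.Prime] (n : ℕ) (g : unitBall q) : (ZMod q)[X] × (ZMod q)[X] :=
  (exists_isConvergent n g).choose

theorem isConvergent_convergent {q : ℕ} [Fact q.Prime] (n : ℕ) (g : unitBall q) :
    IsConvergent n (convergent n g) (g : LaurentSeries (ZMod q)) :=
  (exists_isConvergent n g).choose_spec

theorem convergent_eq_iff {q : ℕ} [Fact q.Prime] {n : ℕ} {g : unitBall q}
    {r : (ZMod q)[X] × (ZMod q)[X]} :
    convergent n g = r ↔ IsConvergent n r (g : LaurentSeries (ZMod q)) :=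
  ⟨fun h => h ▸ isConvergent_convergent n g, fun h => (isConvergent_convergent n g).eq h⟩

/-- The degree of the denominator of the convergent of level `n`. -/
def convDegree {q : ℕ} [Fact q.Prime] (n : ℕ) (g : unitBall q) : ℕ :=
  (convergent n g).2.natDegree

theorem convDegree_le {q : ℕ} [Fact q.Prime] (n : ℕ) (g : unitBall q) : convDegree n g ≤ n :=
  (isConvergent_convergent n g).2.2.1

theorem convergent_eq_of_le {q : ℕ} [Fact q.Prime] {n m : ℕ} {g : unitBall q}
    (h : convDegree n g ≤ m) (hm : m ≤ n) : convergent m g = convergent n g :=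
  convergent_eq_iff.mpr ((isConvergent_convergent n g).mono h hm)

theorem IsConvergent.degree_lt {q : ℕ} [Fact q.Prime] {n : ℕ} {r : (ZMod q)[X] × (ZMod q)[X]}
    {g : unitBall q} (h : IsConvergent n r (g : LaurentSeries (ZMod q))) :
    r.1.degree < r.2.degree := by
  rw [degree_eq_natDegree h.1.ne_zero, degree_lt_iff_coeff_zero]
  intro i hi
  have h1 := h.2.2.2 (-(i : ℤ)) (by omega)
  rw [HahnSeries.coeff_sub, coeff_polyHom_neg, coeff_polyHom_mul_eq_zero (n := 0) le_rfl
    (fun c hc => g.2 c (by omega)) (by omega), zero_sub, neg_eq_zero] at h1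
  exact h1

/-- Level `n + 1` convergents determine level `n` convergents. -/
theorem convergent_eq_of_succ {q : ℕ} [Fact q.Prime] {n : ℕ} {g g' : unitBall q}
    (h : convergent (n + 1) g = convergent (n + 1) g') : convergent n g = convergent n g' := by
  set r := convergent (n + 1) g with hr
  have hg : IsConvergent (n + 1) r (g : LaurentSeries (ZMod q)) := isConvergent_convergent _ _
  have hg' : IsConvergent (n + 1) r (g' : LaurentSeries (ZMod q)) := by
    rw [h]
    exact isConvergent_convergent _ _
  rcases Nat.lt_or_ge n r.2.natDegree with hd | hd
  · have hd' : r.2.natDegree = n + 1 := le_antisymm hg.2.2.1 hd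
    -- Sharing a convergent of full degree `n + 1` forces `g` and `g'` to agree up to exponent `2 n
    -- + 2`; a factor of degree at most `n` then costs too little to affect level `n`.
    have hdiff : ∀ c ≤ ((2 * n + 2 : ℕ) : ℤ),
        ((g' : LaurentSeries (ZMod q)) - g).coeff c = 0 := by
      intro c hc
      refine coeff_eq_zero_of_polyHom_mul hg.1.ne_zero (n := (n : ℤ) + 1) (fun c hc => ?_)
        (by omega)
      have e : polyHom q r.2 * ((g' : LaurentSeries (ZMod q)) - g) =
          (polyHom q r.2 * g' - polyHom q r.1) - (polyHom q r.2 * g - polyHom q r.1) := by ring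
      rw [e, HahnSeries.coeff_sub, hg.2.2.2 c (by omega), hg'.2.2.2 c (by omega), sub_zero]
    set t := convergent n g with ht
    have htg : IsConvergent n t (g : LaurentSeries (ZMod q)) := isConvergent_convergent _ _
    refine (convergent_eq_iff.mpr ⟨htg.1, htg.2.1, htg.2.2.1, fun c hc => ?_⟩).symm
    have e : polyHom q t.2 * (g' : LaurentSeries (ZMod q)) - polyHom q t.1 =
        (polyHom q t.2 * g - polyHom q t.1) + polyHom q t.2 * (g' - g) := by ring
    rw [e, HahnSeries.coeff_add, htg.2.2.2 c hc, zero_add]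
    exact coeff_polyHom_mul_eq_zero htg.2.2.1 hdiff (by push_cast; omega)
  · rw [convergent_eq_of_le hd (Nat.le_succ n)]
    exact (convergent_eq_iff.mpr (hg'.mono hd (Nat.le_succ n))).symm

/-! ### The distribution of convergents -/

theorem countable_polynomial (R : Type*) [Semiring R] [Countable R] : Countable R[X] :=
  Cardinal.mk_le_aleph0_iff.mp <| Polynomial.cardinalMk_le_max.trans <|
    max_le (Cardinal.mk_le_aleph0_iff.mpr inferInstance) le_rfl

theorem measurable_pi_linFormCoeff {q s : ℕ} [Fact q.Prime] {Λ : Type*} (k : Fin s → (ZMod q)[X])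
    (c : Λ → ℤ) (l : Λ) :
    Measurable fun f : Fin s → unitBall q => AddMonoidHom.pi (fun l => linFormCoeff k (c l)) f l :=
  measurable_linFormCoeff k (c l)

/-- Coefficients at exponents up to `-deg Q` vanish automatically, so being the convergent amounts
to the `deg Q + n` conditions at exponents `1 - deg Q, …, n`. -/
theorem setOf_isConvergent {q : ℕ} [Fact q.Prime] {n : ℕ} {r : (ZMod q)[X] × (ZMod q)[X]}
    (h1 : r.2.Monic) (h2 : IsCoprime r.1 r.2) (h3 : r.2.natDegree ≤ n)
    (h4 : r.1.degree < r.2.degree) :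
    {f : Fin 1 → unitBall q | convergent n (f 0) = r} =
      {f | AddMonoidHom.pi (fun l : Fin (r.2.natDegree + n) =>
        linFormCoeff (fun _ => r.2) (1 - (r.2.natDegree : ℤ) + (l : ℕ))) f =
          fun l : Fin (r.2.natDegree + n) => (polyHom q r.1).coeff (1 - (r.2.natDegree : ℤ) + (l : ℕ))} := by
  ext f
  have e : ∀ c, linFormCoeff (fun _ => r.2) c f =
      (polyHom q r.2 * (f 0 : LaurentSeries (ZMod q))).coeff c := fun c => by
    simp [linFormCoeff_apply, linForm]
  simp only [Set.mem_ofPred_eq, convergent_eq_iff, funext_iff, AddMonoidHom.pi_apply, e]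
  constructor
  · intro h l
    have := h.2.2.2 (1 - (r.2.natDegree : ℤ) + (l : ℕ)) (by omega)
    rwa [HahnSeries.coeff_sub, sub_eq_zero] at this
  · intro h
    refine ⟨h1, h2, h3, fun c hc => ?_⟩
    rw [HahnSeries.coeff_sub, sub_eq_zero]
    rcases le_or_gt c (-(r.2.natDegree : ℤ)) with hc' | hc'
    · rw [coeff_polyHom_mul_eq_zero (n := 0) le_rfl (fun c hc => (f 0).2 c (by omega)) (by omega)]
      obtain ⟨i, rfl⟩ : ∃ i : ℕ, c = -(i : ℤ) := ⟨(-c).toNat, by omega⟩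
      rw [degree_eq_natDegree h1.ne_zero, degree_lt_iff_coeff_zero] at h4
      rw [coeff_polyHom_neg, h4 i (by omega)]
    · have := h ⟨(c + r.2.natDegree - 1).toNat, by omega⟩
      simp only at this
      rwa [show 1 - (r.2.natDegree : ℤ) + ((c + r.2.natDegree - 1).toNat : ℕ) = c by omega] at this

theorem haarPi_real_convergent {q : ℕ} [Fact q.Prime] {n : ℕ} {r : (ZMod q)[X] × (ZMod q)[X]}
    (h1 : r.2.Monic) (h2 : IsCoprime r.1 r.2) (h3 : r.2.natDegree ≤ n)
    (h4 : r.1.degree < r.2.degree) :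
    (haarPi q 1).real {f | convergent n (f 0) = r} = ((q : ℝ) ^ (r.2.natDegree + n))⁻¹ := by
  rw [setOf_isConvergent h1 h2 h3 h4]
  refine (haarPi_real_fiber _ (measurable_pi_linFormCoeff _ _) ?_ _).trans
    (by rw [Fintype.card_fin])
  intro α hα
  have h0 : ∀ f : Fin 1 → unitBall q, linFormCoeff (fun _ => polyOfFn α * r.2)
      (1 - (r.2.natDegree : ℤ)) f = 0 := fun f =>
    (sum_mul_linFormCoeff (fun _ => r.2) (1 - (r.2.natDegree : ℤ)) α f).symm.trans (hα f)
  by_contra hne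
  have hp : polyOfFn α ≠ 0 := fun h => hne (eq_zero_of_polyOfFn_eq_zero h)
  have hnd := natDegree_mul hp h1.ne_zero
  have := coeff_eq_zero_of_linFormCoeff h0 0 (i := (polyOfFn α * r.2).natDegree) (by omega)
  exact mul_ne_zero hp h1.ne_zero (leadingCoeff_eq_zero.mp this)

theorem measurableSet_convergent_eq {q : ℕ} [Fact q.Prime] (n : ℕ)
    (r : (ZMod q)[X] × (ZMod q)[X]) :
    MeasurableSet {f : Fin 1 → unitBall q | convergent n (f 0) = r} := by
  by_cases h : r.2.Monic ∧ IsCoprime r.1 r.2 ∧ r.2.natDegree ≤ n ∧ r.1.degree < r.2.degree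
  · rw [setOf_isConvergent h.1 h.2.1 h.2.2.1 h.2.2.2]
    exact measurableSet_fiber (measurable_pi_linFormCoeff _ _) _
  · convert MeasurableSet.empty
    rw [Set.eq_empty_iff_forall_notMem]
    intro f hf
    have hf' := convergent_eq_iff.mp hf
    exact h ⟨hf'.1, hf'.2.1, hf'.2.2.1, hf'.degree_lt⟩

/-- An event determined by the convergent of level `n`. -/
def IsLevel {q : ℕ} [Fact q.Prime] (n : ℕ) (A : Set (Fin 1 → unitBall q)) : Prop :=
  ∀ f g, convergent n (f 0) = convergent n (g 0) → f ∈ A → g ∈ A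

theorem IsLevel.succ {q : ℕ} [Fact q.Prime] {n : ℕ} {A : Set (Fin 1 → unitBall q)}
    (h : IsLevel n A) : IsLevel (n + 1) A :=
  fun f g e => h f g (convergent_eq_of_succ e)

theorem IsLevel.mono {q : ℕ} [Fact q.Prime] {n m : ℕ} {A : Set (Fin 1 → unitBall q)}
    (h : IsLevel n A) (hm : n ≤ m) : IsLevel m A :=
  Nat.le_induction h (fun _ _ ih => ih.succ) m hm

theorem IsLevel.inter {q : ℕ} [Fact q.Prime] {n : ℕ} {A B : Set (Fin 1 → unitBall q)}
    (hA : IsLevel n A) (hB : IsLevel n B) : IsLevel n (A ∩ B) :=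
  fun f g e h => ⟨hA f g e h.1, hB f g e h.2⟩

theorem isLevel_convDegree {q : ℕ} [Fact q.Prime] (n : ℕ) (p : ℕ → Prop) :
    IsLevel (q := q) n {f | p (convDegree n (f 0))} := by
  intro f g e h
  simp only [Set.mem_ofPred_eq, convDegree] at h ⊢
  rwa [← e]

theorem IsLevel.measurableSet {q : ℕ} [Fact q.Prime] {n : ℕ} {A : Set (Fin 1 → unitBall q)}
    (h : IsLevel n A) : MeasurableSet A := by
  have := countable_polynomial (ZMod q)
  have e : A = ⋃ r ∈ (fun f : Fin 1 → unitBall q => convergent n (f 0)) '' A,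
      {f : Fin 1 → unitBall q | convergent n (f 0) = r} := by
    ext f
    simp only [Set.mem_iUnion, Set.mem_ofPred_eq, exists_prop, exists_eq_right', Set.mem_image]
    exact ⟨fun hf => ⟨f, hf, rfl⟩, fun ⟨g, hg, e⟩ => h g f e hg⟩
  rw [e]
  exact MeasurableSet.biUnion (Set.to_countable _) fun r _ => measurableSet_convergent_eq n r

/-- Persistence means being the convergent of level `n + 1` as well, which is one more independent
linear condition. -/
theorem haarPi_real_convergent_inter_le {q : ℕ} [Fact q.Prime] (n : ℕ)
    (r : (ZMod q)[X] × (ZMod q)[X]) :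
    (haarPi q 1).real ({f | convergent n (f 0) = r} ∩ {f | convDegree (n + 1) (f 0) ≤ n}) =
      (q : ℝ)⁻¹ * (haarPi q 1).real {f | convergent n (f 0) = r} := by
  by_cases h : r.2.Monic ∧ IsCoprime r.1 r.2 ∧ r.2.natDegree ≤ n ∧ r.1.degree < r.2.degree
  · obtain ⟨h1, h2, h3, h4⟩ := h
    have e : {f : Fin 1 → unitBall q | convergent n (f 0) = r} ∩
        {f | convDegree (n + 1) (f 0) ≤ n} = {f | convergent (n + 1) (f 0) = r} := by
      ext f
      simp only [Set.mem_inter_iff, Set.mem_ofPred_eq]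
      constructor
      · rintro ⟨ha, hb⟩
        rw [← convergent_eq_of_le hb (Nat.le_succ n), ha]
      · intro ha
        have hb : convDegree (n + 1) (f 0) ≤ n := by
          rw [convDegree, ha]
          exact h3
        exact ⟨(convergent_eq_of_le hb (Nat.le_succ n)).trans ha, hb⟩
    rw [e, haarPi_real_convergent h1 h2 h3 h4, haarPi_real_convergent h1 h2 (by omega) h4,
      ← add_assoc, pow_succ, mul_inv, mul_comm]
  · have e : {f : Fin 1 → unitBall q | convergent n (f 0) = r} = ∅ := by
      rw [Set.eq_empty_iff_forall_notMem]
      intro f hf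
      have hf' := convergent_eq_iff.mp hf
      exact h ⟨hf'.1, hf'.2.1, hf'.2.2.1, hf'.degree_lt⟩
    simp [e]

/-- Given the convergent of level `n`, it persists at level `n + 1` with probability `1 / q`. -/
theorem haarPi_real_inter_convDegree_le {q : ℕ} [Fact q.Prime] {n : ℕ}
    {A : Set (Fin 1 → unitBall q)} (h : IsLevel n A) :
    (haarPi q 1).real (A ∩ {f | convDegree (n + 1) (f 0) ≤ n}) =
      (q : ℝ)⁻¹ * (haarPi q 1).real A := by
  have := countable_polynomial (ZMod q)
  set μ := haarPi q 1
  set V := {f : Fin 1 → unitBall q | convDegree (n + 1) (f 0) ≤ n} with hV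
  have hVm : MeasurableSet V := (isLevel_convDegree (n + 1) fun d => d ≤ n).measurableSet
  let _ : MeasurableSpace ((ZMod q)[X] × (ZMod q)[X]) := ⊤
  set X : (Fin 1 → unitBall q) → (ZMod q)[X] × (ZMod q)[X] := fun f => convergent n (f 0) with hX
  have hXm : Measurable X := measurable_to_countable' fun r => measurableSet_convergent_eq n r
  have hq : (q : ENNReal) ≠ 0 := by exact_mod_cast (Fact.out : q.Prime).ne_zero
  -- The pairs of polynomials form a countable space, so the measures can be compared on single
  -- convergents.
  have key : (μ.restrict V).map X = (q : ENNReal)⁻¹ • μ.map X := by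
    rw [Measure.ext_iff_singleton]
    intro r
    have hs : MeasurableSet ({r} : Set ((ZMod q)[X] × (ZMod q)[X])) := trivial
    rw [Measure.map_apply hXm hs, Measure.restrict_apply (hXm hs), Measure.smul_apply,
      Measure.map_apply hXm hs, smul_eq_mul]
    rw [← ENNReal.toReal_eq_toReal_iff' (measure_ne_top _ _)
      (ENNReal.mul_ne_top (ENNReal.inv_ne_top.mpr hq) (measure_ne_top _ _)), ENNReal.toReal_mul,
      ENNReal.toReal_inv, ENNReal.toReal_natCast]
    exact haarPi_real_convergent_inter_le n r
  have e : A = X ⁻¹' (X '' A) := by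
    ext f
    exact ⟨fun hf => ⟨f, hf, rfl⟩, fun ⟨g, hg, e⟩ => h g f e hg⟩
  have h1 := congrArg (fun ν => (ν (X '' A)).toReal) key
  have hs : MeasurableSet (X '' A) := trivial
  rwa [Measure.map_apply hXm hs, ← e, Measure.restrict_apply h.measurableSet, Measure.smul_apply,
    Measure.map_apply hXm hs, ← e, smul_eq_mul, ENNReal.toReal_mul, ENNReal.toReal_inv,
    ENNReal.toReal_natCast] at h1

/-- Renewal property: whatever happened up to level `n`, a new denominator appears at level `n + 1`
with probability `1 - 1/q`, and survives each further level with probability `1/q`. -/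
theorem haarPi_real_inter_convDegree_eq {q : ℕ} [Fact q.Prime] {n : ℕ}
    {A : Set (Fin 1 → unitBall q)} (h : IsLevel n A) (D : ℕ) :
    (haarPi q 1).real (A ∩ {f | convDegree (n + 1 + D) (f 0) = n + 1}) =
      (1 - (q : ℝ)⁻¹) * ((q : ℝ) ^ D)⁻¹ * (haarPi q 1).real A := by
  induction D with
  | zero =>
    have h1 := haarPi_real_inter_convDegree_le h
    have h2 := measureReal_inter_add_sdiff (μ := haarPi q 1) (s := A)
      (isLevel_convDegree (q := q) (n + 1) fun d => d ≤ n).measurableSet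
    have e : A \ {f | convDegree (n + 1) (f 0) ≤ n} =
        A ∩ {f | convDegree (n + 1 + 0) (f 0) = n + 1} := by
      ext f
      have := convDegree_le (n + 1) (f 0)
      simp only [Set.mem_sdiff, Set.mem_ofPred_eq, Set.mem_inter_iff, add_zero]
      refine and_congr_right fun _ => ?_
      omega
    rw [← e, pow_zero, inv_one]
    linarith
  | succ D ih =>
    have hl : IsLevel (n + 1 + D) (A ∩ {f | convDegree (n + 1 + D) (f 0) = n + 1}) :=
      (h.mono (by omega)).inter (isLevel_convDegree _ fun d => d = n + 1)
    have h1 := haarPi_real_inter_convDegree_le hl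
    have e : A ∩ {f | convDegree (n + 1 + D) (f 0) = n + 1} ∩
        {f | convDegree (n + 1 + D + 1) (f 0) ≤ n + 1 + D} =
        A ∩ {f | convDegree (n + 1 + (D + 1)) (f 0) = n + 1} := by
      ext f
      simp only [Set.mem_ofPred_eq, Set.mem_inter_iff, and_assoc]
      refine and_congr_right fun _ => ?_
      rw [← add_assoc]
      constructor
      · rintro ⟨ha, hb⟩
        rwa [convDegree, convergent_eq_of_le hb (Nat.le_succ _)] at ha
      · intro ha
        have hb : convDegree (n + 1 + D + 1) (f 0) ≤ n + 1 + D := by omega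
        refine ⟨?_, hb⟩
        rw [convDegree, convergent_eq_of_le hb (Nat.le_succ _)]
        exact ha
    rw [← e, h1, ih, pow_succ, mul_inv]
    ring

theorem haarPi_real_convDegree_eq {q : ℕ} [Fact q.Prime] {m : ℕ} (hm : 1 ≤ m) (D : ℕ) :
    (haarPi q 1).real {f | convDegree (m + D) (f 0) = m} =
      (1 - (q : ℝ)⁻¹) * ((q : ℝ) ^ D)⁻¹ := by
  obtain ⟨n, rfl⟩ := Nat.exists_eq_add_of_le' hm
  have := haarPi_real_inter_convDegree_eq (q := q) (n := n) (A := Set.univ)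
    (fun _ _ _ _ => trivial) D
  rwa [Set.univ_inter, probReal_univ, mul_one] at this

/-- If `m + D < m'`, the first event is decided before level `m'` and renewal gives independence.
Otherwise the convergent of level `m'` would have both degrees, so the events are disjoint. -/
theorem haarPi_real_convDegree_inter_le {q : ℕ} [Fact q.Prime] {m m' : ℕ} (hm : 1 ≤ m)
    (hmm : m < m') (D D' : ℕ) :
    (haarPi q 1).real ({f | convDegree (m + D) (f 0) = m} ∩
      {f | convDegree (m' + D') (f 0) = m'}) ≤
    (haarPi q 1).real {f | convDegree (m + D) (f 0) = m} *
      (haarPi q 1).real {f | convDegree (m' + D') (f 0) = m'} := by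
  rcases Nat.lt_or_ge (m + D) m' with h | h
  · obtain ⟨n, rfl⟩ := Nat.exists_eq_add_of_le' (hm.trans hmm.le)
    rw [haarPi_real_inter_convDegree_eq (n := n), haarPi_real_convDegree_eq (m := n + 1) (by omega),
      mul_comm]
    exact (isLevel_convDegree _ fun d => d = m).mono (by omega)
  · have e : {f : Fin 1 → unitBall q | convDegree (m + D) (f 0) = m} ∩
        {f | convDegree (m' + D') (f 0) = m'} = ∅ := by
      rw [Set.eq_empty_iff_forall_notMem]
      rintro f ⟨h1, h2⟩
      simp only [Set.mem_ofPred_eq] at h1 h2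
      have e1 : convergent m' (f 0) = convergent (m + D) (f 0) :=
        convergent_eq_of_le (by omega) h
      have e2 : convergent m' (f 0) = convergent (m' + D') (f 0) :=
        convergent_eq_of_le (by omega) (by omega)
      rw [convDegree, ← e1] at h1
      rw [convDegree, ← e2] at h2
      omega
    rw [e, measureReal_empty]
    positivity

/-! ### Infinitely many small linear forms -/

/-- The number of extra vanishing coefficients required on the scale `q ^ i`. -/
def excess (q s i : ℕ) : ℕ := s * i + Nat.log q i

theorem pow_excess_le {q : ℕ} (s i : ℕ) : q ^ excess q s i ≤ (q ^ i) ^ s * (i + 1) := by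
  rw [excess, pow_add, mul_comm s, pow_mul]
  refine Nat.mul_le_mul_left _ ?_
  rcases Nat.eq_zero_or_pos i with rfl | hi
  · simp
  · exact (Nat.pow_log_le_self q hi.ne').trans (Nat.le_succ i)

theorem le_pow_excess {q : ℕ} (hq : 1 < q) (s i : ℕ) :
    (q ^ i) ^ s * i ≤ q * q ^ excess q s i := by
  rw [excess, pow_add, mul_comm s, pow_mul, mul_left_comm, ← pow_succ']
  exact Nat.mul_le_mul_left _ (Nat.lt_pow_succ_log_self hq i).le

/-- At scale `q ^ i` some linear form with polynomial coefficients is exceptionally small. -/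
def HasSmallForm {q s : ℕ} (f : Fin s → unitBall q) (i : ℕ) : Prop :=
  ∃ k : Fin s → (ZMod q)[X], (∃ j, k j ≠ 0) ∧ ∑ j, (k j).natDegree ≤ (s + 1) * q ^ (i + 1) ∧
    f ∈ smallForm k (∑ j, (k j).natDegree + excess q s i)

theorem one_sub_inv_pos (q : ℕ) [Fact q.Prime] : 0 < 1 - (q : ℝ)⁻¹ := by
  have : 1 < (q : ℝ) := by exact_mod_cast (Fact.out : q.Prime).one_lt
  rw [sub_pos]
  exact inv_lt_one_of_one_lt₀ this

theorem pow_le_card_Ico {q : ℕ} (hq : 2 ≤ q) (i : ℕ) :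
    q ^ i ≤ (Finset.Ico (q ^ i) (q ^ (i + 1))).card := by
  rw [Nat.card_Ico, pow_succ]
  have : q ^ i * 2 ≤ q ^ i * q := Nat.mul_le_mul_left _ hq
  omega

theorem eq_of_mem_Ico_pow {q i i' m : ℕ} (h : m ∈ Finset.Ico (q ^ i) (q ^ (i + 1)))
    (h' : m ∈ Finset.Ico (q ^ i') (q ^ (i' + 1))) : i = i' := by
  rw [Finset.mem_Ico] at h h'
  rw [← Nat.log_eq_of_pow_le_of_lt_pow h.1 h.2, Nat.log_eq_of_pow_le_of_lt_pow h'.1 h'.2]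

/-- The choice of `excess` makes the mass of a block of `B ≥ q^(is)` units at least harmonic in `i`,
which is what divergence needs. -/
theorem div_succ_le_excess {q : ℕ} [Fact q.Prime] (s i : ℕ) {B : ℝ} (hB : (q ^ i : ℝ) ^ s ≤ B) :
    (1 - (q : ℝ)⁻¹) / ((i : ℝ) + 1) ≤ B * ((1 - (q : ℝ)⁻¹) * ((q : ℝ) ^ excess q s i)⁻¹) := by
  have hq0 : 0 < (q : ℝ) := by exact_mod_cast (Fact.out : q.Prime).pos
  have hc := one_sub_inv_pos q
  have h1 : (q : ℝ) ^ excess q s i ≤ (q ^ i : ℝ) ^ s * (i + 1) := by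
    exact_mod_cast pow_excess_le (q := q) s i
  rw [mul_left_comm, div_eq_mul_inv]
  refine mul_le_mul_of_nonneg_left ?_ hc.le
  rw [← div_eq_mul_inv, le_div_iff₀ (by positivity), inv_mul_le_iff₀ (by positivity), mul_comm]
  exact h1.trans (mul_le_mul_of_nonneg_right hB (by positivity))

theorem mem_smallForm_of_convDegree {q : ℕ} [Fact q.Prime] {n : ℕ} {f : Fin 1 → unitBall q} :
    f ∈ smallForm (fun _ => (convergent n (f 0)).2) n := by
  intro c hc
  have h := (isConvergent_convergent n (f 0)).2.2.2 ((c : ℤ) + 1) (by omega)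
  rw [HahnSeries.coeff_sub, coeff_polyHom_of_pos _ (by omega), sub_zero] at h
  simpa [linFormCoeff_apply, linForm] using h

/-- A denominator of degree `m` that is still the convergent at level `m + excess` is itself the
coefficient of a small form. -/
theorem ae_infinite_hasSmallForm_one (q : ℕ) [Fact q.Prime] :
    ∀ᵐ f ∂haarPi q 1, {i | HasSmallForm f i}.Infinite := by
  have hq2 := (Fact.out : q.Prime).two_le
  have hqpos := (Fact.out : q.Prime).pos
  have hone : ∀ i m, m ∈ Finset.Ico (q ^ i) (q ^ (i + 1)) → 1 ≤ m := fun i m hm =>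
    (Nat.one_le_pow _ _ hqpos).trans (Finset.mem_Ico.mp hm).1
  have main := ae_infinite_of_pairwise (haarPi q 1)
    (fun i => Finset.Ico (q ^ i) (q ^ (i + 1)))
    (fun i m => {f | convDegree (m + excess q 1 i) (f 0) = m})
    (fun i m _ => (isLevel_convDegree _ fun d => d = m).measurableSet)
    (fun i i' m m' hm hm' hne => by
      rcases lt_trichotomy m m' with h | rfl | h
      · exact haarPi_real_convDegree_inter_le (hone i m hm) h _ _
      · exact absurd (congrArg (·, m) (eq_of_mem_Ico_pow hm hm')) hne
      · rw [Set.inter_comm, mul_comm]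
        exact haarPi_real_convDegree_inter_le (hone i' m' hm') h _ _)
    (one_sub_inv_pos q) fun i => by
      rw [Finset.sum_congr rfl fun m hm => haarPi_real_convDegree_eq (hone i m hm) _,
        Finset.sum_const, nsmul_eq_mul]
      refine div_succ_le_excess 1 i ?_
      rw [pow_one]
      exact_mod_cast pow_le_card_Ico hq2 i
  filter_upwards [main] with f hf
  refine hf.mono ?_
  rintro i ⟨m, hm, hfm⟩
  have hd : (convergent (m + excess q 1 i) (f 0)).2.natDegree = m := hfm
  refine ⟨fun _ => (convergent (m + excess q 1 i) (f 0)).2, ⟨0, ?_⟩, ?_, ?_⟩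
  · exact (isConvergent_convergent _ _).1.ne_zero
  · simp only [Finset.univ_unique, Finset.sum_const, Finset.card_singleton, one_smul, hd]
    have := (Finset.mem_Ico.mp hm).2
    omega
  · have : ∑ _j : Fin 1, (convergent (m + excess q 1 i) (f 0)).2.natDegree = m := by simp [hd]
    rw [this]
    exact mem_smallForm_of_convDegree

/-! ### Counting reduced fractions and monic polynomials -/

theorem finite_degree_lt {K : Type*} [Field K] [Finite K] (n : ℕ) :
    {p : K[X] | p.degree < n}.Finite := by
  have : Finite (degreeLT K n) := Finite.of_equiv _ (degreeLTEquiv K n).toEquiv.symm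
  refine Set.Finite.subset (Set.toFinite (degreeLT K n : Set K[X])) fun p hp => ?_
  exact mem_degreeLT.mpr hp

/-- The number of reduced fractions with monic denominator of degree `b`. -/
theorem exists_finset_fractions (q : ℕ) [Fact q.Prime] {b : ℕ} (hb : 1 ≤ b) :
    ∃ T : Finset ((ZMod q)[X] × (ZMod q)[X]),
      (∀ r ∈ T, r.2.Monic ∧ IsCoprime r.1 r.2 ∧ r.2.natDegree = b ∧ r.1.degree < r.2.degree) ∧
      (T.card : ℝ) * ((q : ℝ) ^ (2 * b))⁻¹ = 1 - (q : ℝ)⁻¹ := by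
  have hfin : {r : (ZMod q)[X] × (ZMod q)[X] | r.2.Monic ∧ IsCoprime r.1 r.2 ∧
      r.2.natDegree = b ∧ r.1.degree < r.2.degree}.Finite := by
    refine ((finite_degree_lt (K := ZMod q) (b + 1)).prod
      (finite_degree_lt (K := ZMod q) (b + 1))).subset ?_
    rintro r ⟨h1, -, h3, h4⟩
    have h5 : r.2.degree < ((b + 1 : ℕ) : WithBot ℕ) := by
      rw [degree_eq_natDegree h1.ne_zero, h3]
      exact_mod_cast Nat.lt_succ_self b
    exact ⟨h4.trans h5, h5⟩
  refine ⟨hfin.toFinset, fun r hr => by simpa using hr, ?_⟩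
  -- The count is read off from the measure: an event of mass `1 - 1/q` splits into one piece of
  -- mass `q^(-2b)` for each fraction.
  have h1 := haarPi_real_convDegree_eq (q := q) hb 0
  have e : {f : Fin 1 → unitBall q | convDegree (b + 0) (f 0) = b} =
      ⋃ r ∈ hfin.toFinset, {f : Fin 1 → unitBall q | convergent b (f 0) = r} := by
    ext f
    simp only [Set.mem_iUnion, Set.mem_ofPred_eq, exists_prop, exists_eq_right', add_zero,
      Set.Finite.mem_toFinset]
    have := isConvergent_convergent b (f 0)
    exact ⟨fun h => ⟨this.1, this.2.1, h, this.degree_lt⟩, fun h => h.2.2.1⟩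
  have hmass : ∀ r ∈ hfin.toFinset, (haarPi q 1).real
      {f : Fin 1 → unitBall q | convergent b (f 0) = r} = ((q : ℝ) ^ (2 * b))⁻¹ := by
    intro r hr
    obtain ⟨h1, h2, h3, h4⟩ := hfin.mem_toFinset.mp hr
    rw [haarPi_real_convergent h1 h2 h3.le h4, h3, two_mul]
  rw [e, measureReal_biUnion_finset, Finset.sum_congr rfl hmass, Finset.sum_const, nsmul_eq_mul,
    pow_zero, inv_one, mul_one] at h1
  · exact h1
  · intro r _ r' _ hne
    refine Set.disjoint_left.mpr fun f h h' => hne ?_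
    exact h.symm.trans h'
  · exact fun r _ => measurableSet_convergent_eq b r

/-- The reduced fractions with monic denominator of degree `b`. -/
def fractions (q : ℕ) [Fact q.Prime] (b : ℕ) : Finset ((ZMod q)[X] × (ZMod q)[X]) :=
  if hb : 1 ≤ b then (exists_finset_fractions q hb).choose else ∅

theorem of_mem_fractions {q : ℕ} [Fact q.Prime] {b : ℕ} {r : (ZMod q)[X] × (ZMod q)[X]}
    (hr : r ∈ fractions q b) :
    r.2.Monic ∧ IsCoprime r.1 r.2 ∧ r.2.natDegree = b ∧ r.1.degree < r.2.degree := by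
  unfold fractions at hr
  split_ifs at hr with hb
  · exact (exists_finset_fractions q hb).choose_spec.1 r hr
  · simp at hr

theorem sum_fractions {q : ℕ} [Fact q.Prime] {b : ℕ} (hb : 1 ≤ b) :
    ∑ r ∈ fractions q b, ((q : ℝ) ^ (2 * r.2.natDegree))⁻¹ = 1 - (q : ℝ)⁻¹ := by
  rw [Finset.sum_congr rfl fun r hr => by rw [(of_mem_fractions hr).2.2.1], Finset.sum_const,
    nsmul_eq_mul, fractions, dif_pos hb]
  exact (exists_finset_fractions q hb).choose_spec.2

open Classical in
/-- The monic polynomials of degree `e`. -/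
def monics (q : ℕ) [Fact q.Prime] (e : ℕ) : Finset (ZMod q)[X] :=
  Finset.univ.image fun α : Fin e → ZMod q => X ^ e + polyOfFn α

theorem degree_polyOfFn_lt {q n : ℕ} [Fact q.Prime] (α : Fin n → ZMod q) :
    (polyOfFn α).degree < n := by
  rw [polyOfFn, ← mem_degreeLT]
  exact Submodule.sum_mem _ fun i _ => mem_degreeLT.mpr
    ((degree_monomial_le _ _).trans_lt (by exact_mod_cast i.2))

theorem of_mem_monics {q : ℕ} [Fact q.Prime] {e : ℕ} {u : (ZMod q)[X]} (hu : u ∈ monics q e) :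
    u.Monic ∧ u.natDegree = e := by
  classical
  obtain ⟨α, -, rfl⟩ := Finset.mem_image.mp hu
  refine ⟨monic_X_pow_add (degree_polyOfFn_lt α), ?_⟩
  refine natDegree_eq_of_degree_eq_some ?_
  rw [degree_add_eq_left_of_degree_lt, degree_X_pow]
  rw [degree_X_pow]
  exact degree_polyOfFn_lt α

theorem sum_monics {q : ℕ} [Fact q.Prime] (e : ℕ) :
    ∑ u ∈ monics q e, ((q : ℝ) ^ u.natDegree)⁻¹ = 1 := by
  classical
  have hq : (q : ℝ) ≠ 0 := by exact_mod_cast (Fact.out : q.Prime).ne_zero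
  rw [Finset.sum_congr rfl fun u hu => by rw [(of_mem_monics hu).2], Finset.sum_const,
    nsmul_eq_mul, monics, Finset.card_image_of_injective, Finset.card_univ, Fintype.card_fun,
    ZMod.card, Fintype.card_fin, Nat.cast_pow, mul_inv_cancel₀ (pow_ne_zero _ hq)]
  intro α β h
  have h' : polyOfFn α = polyOfFn β := add_left_cancel h
  ext i
  rw [← coeff_polyOfFn α i, h', coeff_polyOfFn]

open Classical in
/-- The reduced fractions with denominators on the scale `q ^ i`. -/
def fractionBlock (q : ℕ) [Fact q.Prime] (i : ℕ) : Finset ((ZMod q)[X] × (ZMod q)[X]) :=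
  (Finset.Ico (q ^ i) (q ^ (i + 1))).biUnion (fractions q)

open Classical in
/-- The monic polynomials with degrees on the scale `q ^ i`. -/
def monicBlock (q : ℕ) [Fact q.Prime] (i : ℕ) : Finset (ZMod q)[X] :=
  (Finset.Ico (q ^ i) (q ^ (i + 1))).biUnion (monics q)

theorem of_mem_fractionBlock {q : ℕ} [Fact q.Prime] {i : ℕ} {r : (ZMod q)[X] × (ZMod q)[X]}
    (hr : r ∈ fractionBlock q i) : r.2.Monic ∧ IsCoprime r.1 r.2 ∧
      r.2.natDegree ∈ Finset.Ico (q ^ i) (q ^ (i + 1)) ∧ r.1.degree < r.2.degree := by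
  classical
  obtain ⟨b, hb, hr⟩ := Finset.mem_biUnion.mp hr
  obtain ⟨h1, h2, rfl, h4⟩ := of_mem_fractions hr
  exact ⟨h1, h2, hb, h4⟩

theorem of_mem_monicBlock {q : ℕ} [Fact q.Prime] {i : ℕ} {u : (ZMod q)[X]}
    (hu : u ∈ monicBlock q i) : u.Monic ∧ u.natDegree ∈ Finset.Ico (q ^ i) (q ^ (i + 1)) := by
  classical
  obtain ⟨b, hb, hu⟩ := Finset.mem_biUnion.mp hu
  obtain ⟨h1, rfl⟩ := of_mem_monics hu
  exact ⟨h1, hb⟩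

theorem sum_fractionBlock {q : ℕ} [Fact q.Prime] (i : ℕ) :
    ∑ r ∈ fractionBlock q i, ((q : ℝ) ^ (2 * r.2.natDegree))⁻¹ =
      (Finset.Ico (q ^ i) (q ^ (i + 1))).card * (1 - (q : ℝ)⁻¹) := by
  classical
  rw [fractionBlock, Finset.sum_biUnion, Finset.sum_congr rfl fun b hb => sum_fractions
    ((Nat.one_le_pow i q (Fact.out : q.Prime).pos).trans (Finset.mem_Ico.mp hb).1),
    Finset.sum_const, nsmul_eq_mul]
  intro b _ b' _ hne
  exact Finset.disjoint_left.mpr fun r h h' =>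
    hne ((of_mem_fractions h).2.2.1.symm.trans (of_mem_fractions h').2.2.1)

theorem sum_monicBlock {q : ℕ} [Fact q.Prime] (i : ℕ) :
    ∑ u ∈ monicBlock q i, ((q : ℝ) ^ u.natDegree)⁻¹ =
      (Finset.Ico (q ^ i) (q ^ (i + 1))).card := by
  classical
  rw [monicBlock, Finset.sum_biUnion, Finset.sum_congr rfl fun b _ => sum_monics b,
    Finset.sum_const, nsmul_eq_mul, mul_one]
  intro b _ b' _ hne
  exact Finset.disjoint_left.mpr fun r h h' =>
    hne ((of_mem_monics h).2.symm.trans (of_mem_monics h').2)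

/-! ### Primitive coefficient vectors in dimension at least two -/

/-- The primitive coefficient vector with first entries `Q u + P` and `Q`. -/
def primitiveVector {q s : ℕ}
    (x : (((ZMod q)[X] × (ZMod q)[X]) × (ZMod q)[X]) × (Fin s → (ZMod q)[X])) :
    Fin (s + 2) → (ZMod q)[X] :=
  Fin.cons (x.1.1.1 + x.1.1.2 * x.1.2) (Fin.cons x.1.1.2 x.2)

/-- The parameters of the primitive vectors on the scale `q ^ i`. -/
def vectorBlock (q : ℕ) [Fact q.Prime] (s i : ℕ) :
    Finset ((((ZMod q)[X] × (ZMod q)[X]) × (ZMod q)[X]) × (Fin s → (ZMod q)[X])) :=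
  (fractionBlock q i ×ˢ monicBlock q i) ×ˢ Fintype.piFinset fun _ => monicBlock q i

theorem mem_vectorBlock {q : ℕ} [Fact q.Prime] {s i : ℕ}
    {x : (((ZMod q)[X] × (ZMod q)[X]) × (ZMod q)[X]) × (Fin s → (ZMod q)[X])} :
    x ∈ vectorBlock q s i ↔
      (x.1.1 ∈ fractionBlock q i ∧ x.1.2 ∈ monicBlock q i) ∧ ∀ j, x.2 j ∈ monicBlock q i := by
  simp [vectorBlock]

section

variable {q : ℕ} [Fact q.Prime] {s i : ℕ}
  {x : (((ZMod q)[X] × (ZMod q)[X]) × (ZMod q)[X]) × (Fin s → (ZMod q)[X])}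

theorem degree_lt_of_mem_vectorBlock (hx : x ∈ vectorBlock q s i) :
    x.1.1.1.degree < (x.1.1.2 * x.1.2).degree := by
  obtain ⟨⟨hr, hu⟩, -⟩ := mem_vectorBlock.mp hx
  refine (of_mem_fractionBlock hr).2.2.2.trans_le ?_
  exact degree_le_mul_left _ (of_mem_monicBlock hu).1.ne_zero

theorem sum_natDegree_primitiveVector (hx : x ∈ vectorBlock q s i) :
    ∑ j, (primitiveVector x j).natDegree =
      2 * x.1.1.2.natDegree + x.1.2.natDegree + ∑ j, (x.2 j).natDegree := by
  obtain ⟨⟨hr, hu⟩, -⟩ := mem_vectorBlock.mp hx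
  rw [Fin.sum_univ_succ, Fin.sum_univ_succ]
  simp only [primitiveVector, Fin.cons_zero, Fin.cons_succ]
  rw [natDegree_add_eq_right_of_degree_lt (degree_lt_of_mem_vectorBlock hx),
    (of_mem_fractionBlock hr).1.natDegree_mul (of_mem_monicBlock hu).1]
  ring

theorem monic_primitiveVector_one (hx : x ∈ vectorBlock q s i) : (primitiveVector x 1).Monic :=
  (of_mem_fractionBlock (mem_vectorBlock.mp hx).1.1).1

theorem isCoprime_primitiveVector (hx : x ∈ vectorBlock q s i) :
    IsCoprime (primitiveVector x 0) (primitiveVector x 1) :=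
  IsCoprime.add_mul_left_left (of_mem_fractionBlock (mem_vectorBlock.mp hx).1.1).2.1 _

/-- `P` and `u` are recovered as remainder and quotient on dividing the first entry by `Q`; the
scale `i` is recovered from `deg Q`. -/
theorem primitiveVector_injective {i' : ℕ}
    {x' : (((ZMod q)[X] × (ZMod q)[X]) × (ZMod q)[X]) × (Fin s → (ZMod q)[X])}
    (hx : x ∈ vectorBlock q s i) (hx' : x' ∈ vectorBlock q s i')
    (h : primitiveVector x = primitiveVector x') : (i, x) = (i', x') := by
  obtain ⟨⟨hr, hu⟩, -⟩ := mem_vectorBlock.mp hx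
  obtain ⟨⟨hr', hu'⟩, -⟩ := mem_vectorBlock.mp hx'
  obtain ⟨⟨⟨P, Q⟩, u⟩, w⟩ := x
  obtain ⟨⟨⟨P', Q'⟩, u'⟩, w'⟩ := x'
  obtain ⟨h0, h1⟩ := Fin.cons_inj.mp h
  obtain ⟨h1, h2⟩ := Fin.cons_inj.mp h1
  simp only at h0 h1 h2 hr hr' hu hu'
  subst h1 h2
  have hd := of_mem_fractionBlock hr
  have hd' := of_mem_fractionBlock hr'
  have e := div_modByMonic_unique u P hd.1 ⟨rfl, hd.2.2.2⟩
  have e' := div_modByMonic_unique u' P' hd.1 ⟨h0.symm, hd'.2.2.2⟩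
  obtain rfl := e.1.symm.trans e'.1
  obtain rfl := e.2.symm.trans e'.2
  rw [eq_of_mem_Ico_pow hd.2.2.1 hd'.2.2.1]

theorem sum_natDegree_primitiveVector_le (hx : x ∈ vectorBlock q s i) :
    ∑ j, (primitiveVector x j).natDegree ≤ (s + 2 + 1) * q ^ (i + 1) := by
  rw [sum_natDegree_primitiveVector hx]
  obtain ⟨⟨hr, hu⟩, hw⟩ := mem_vectorBlock.mp hx
  have h1 := (Finset.mem_Ico.mp (of_mem_fractionBlock hr).2.2.1).2
  have h2 := (Finset.mem_Ico.mp (of_mem_monicBlock hu).2).2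
  have h3 : ∑ j, (x.2 j).natDegree ≤ ∑ _j : Fin s, q ^ (i + 1) :=
    Finset.sum_le_sum fun j _ => (Finset.mem_Ico.mp (of_mem_monicBlock (hw j)).2).2.le
  rw [Finset.sum_const, Finset.card_univ, Fintype.card_fin, smul_eq_mul] at h3
  linarith

end

/-- The weight factorizes over the parameters: the fraction, `u` and each of the `s` free entries
contribute one factor equal to the number of degrees on the scale, the fraction also `1 - 1/q`. -/
theorem sum_vectorBlock {q : ℕ} [Fact q.Prime] (s i : ℕ) :
    ∑ x ∈ vectorBlock q s i, ((q : ℝ) ^ ∑ j, (primitiveVector x j).natDegree)⁻¹ =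
      ((Finset.Ico (q ^ i) (q ^ (i + 1))).card : ℝ) ^ (s + 2) * (1 - (q : ℝ)⁻¹) := by
  rw [Finset.sum_congr rfl fun x hx => by rw [sum_natDegree_primitiveVector hx, pow_add, pow_add,
      mul_inv, mul_inv, ← Finset.prod_pow_eq_pow_sum, ← Finset.prod_inv_distrib],
    vectorBlock, Finset.sum_product, Finset.sum_product]
  simp only [← Finset.mul_sum, ← Finset.sum_mul]
  rw [sum_fractionBlock, sum_monicBlock,
    ← Finset.prod_univ_sum (fun _ : Fin s => monicBlock q i)
      fun _ u => ((q : ℝ) ^ u.natDegree)⁻¹, Finset.prod_const, sum_monicBlock,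
    Finset.card_univ, Fintype.card_fin]
  ring

/-- Distinct primitive vectors with normalized second entry are not parallel. -/
theorem eq_zero_of_parallel {q s : ℕ} [Fact q.Prime] {k k' : Fin (s + 2) → (ZMod q)[X]}
    (h1 : (k 1).Monic) (h : IsCoprime (k 0) (k 1)) (h1' : (k' 1).Monic)
    (h' : IsCoprime (k' 0) (k' 1)) (hne : k ≠ k') (a b : (ZMod q)[X])
    (hab : ∀ j, a * k j + b * k' j = 0) : a = 0 ∧ b = 0 := by
  by_cases ha : a = 0
  · refine ⟨ha, ?_⟩
    have := hab 1
    rw [ha, zero_mul, zero_add] at this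
    exact (mul_eq_zero.mp this).resolve_right h1'.ne_zero
  · exfalso
    -- Parallel vectors have the same ratio of the first two entries; reducedness and monicity then
    -- make these entries equal.
    have e : k 1 * k' 0 = k' 1 * k 0 := by
      refine mul_left_cancel₀ ha ?_
      linear_combination k' 0 * hab 1 - k' 1 * hab 0
    obtain ⟨e0, e1⟩ := eq_of_monic_of_isCoprime_of_mul_eq h1 h1' h h' e
    have hb : a + b = 0 := by
      have := hab 1
      rw [← e1, ← add_mul] at this
      exact (mul_eq_zero.mp this).resolve_right h1.ne_zero
    apply hne
    funext j
    refine mul_left_cancel₀ ha ?_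
    linear_combination hab j - k' j * hb

/-- Distinct parameters give non-parallel vectors, so the events are pairwise independent, and the
block masses are bounded below by a harmonic series. -/
theorem ae_infinite_hasSmallForm_add_two (q s : ℕ) [Fact q.Prime] :
    ∀ᵐ f ∂haarPi q (s + 2), {i | HasSmallForm f i}.Infinite := by
  have hq2 := (Fact.out : q.Prime).two_le
  have hne0 : ∀ {i x}, x ∈ vectorBlock q s i → primitiveVector x ≠ 0 := fun hx h =>
    (monic_primitiveVector_one hx).ne_zero (congrFun h 1)
  have main := ae_infinite_of_pairwise (haarPi q (s + 2)) (vectorBlock q s)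
    (fun i x => smallForm (primitiveVector x)
      (∑ j, (primitiveVector x j).natDegree + excess q (s + 2) i))
    (fun i x _ => measurableSet_smallForm _ _)
    (fun i i' x x' hx hx' hne => by
      rw [haarPi_real_smallForm (hne0 hx), haarPi_real_smallForm (hne0 hx')]
      refine (haarPi_real_smallForm_inter ?_ _ _).le
      exact eq_zero_of_parallel (monic_primitiveVector_one hx)
        (isCoprime_primitiveVector hx) (monic_primitiveVector_one hx')
        (isCoprime_primitiveVector hx') fun h => hne (primitiveVector_injective hx hx' h))
    (one_sub_inv_pos q) fun i => by
      rw [Finset.sum_congr rfl fun x hx => by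
        rw [haarPi_real_smallForm (hne0 hx), pow_add, mul_inv], ← Finset.sum_mul, sum_vectorBlock,
        mul_assoc]
      refine div_succ_le_excess (s + 2) i ?_
      refine pow_le_pow_left₀ (by positivity) ?_ _
      exact_mod_cast pow_le_card_Ico hq2 i
  filter_upwards [main] with f hf
  refine hf.mono ?_
  rintro i ⟨x, hx, hfx⟩
  exact ⟨primitiveVector x, Function.ne_iff.mp (hne0 hx), sum_natDegree_primitiveVector_le hx, hfx⟩

/-! ### From small linear forms to large discrepancy -/

theorem ae_infinite_hasSmallForm (q : ℕ) [Fact q.Prime] {s : ℕ} (hs : 1 ≤ s) :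
    ∀ᵐ f ∂haarPi q s, {i | HasSmallForm f i}.Infinite := by
  obtain _ | _ | s := s
  · omega
  · exact ae_infinite_hasSmallForm_one q
  · exact ae_infinite_hasSmallForm_add_two q s

theorem excess_le {q : ℕ} (hq : 1 < q) (s i : ℕ) : excess q s i ≤ (s + 1) * q ^ i := by
  have h1 : i ≤ q ^ i := (Nat.lt_pow_self hq).le
  have h2 : Nat.log q i ≤ i := Nat.log_le_self q i
  unfold excess
  nlinarith

/-- The constant in the discrepancy bound. -/
def discrepancyConst (q s : ℕ) : ℝ :=
  (4 * (q : ℝ) ^ s * (((s + 1) * (q + 1) * Real.log q) ^ s *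
    ((|Real.log ((s + 1) * (q + 1) * Real.log q)| + Real.log q) * q)))⁻¹

theorem discrepancyConst_pos (q s : ℕ) [Fact q.Prime] : 0 < discrepancyConst q s := by
  have hq : 1 < (q : ℝ) := by exact_mod_cast (Fact.out : q.Prime).one_lt
  have := Real.log_pos hq
  unfold discrepancyConst
  positivity

/-- With `N = q^M`, `C` bounds `log N / q^i` and `B` bounds `log log N / i`. The factor `q` pays for
rounding in `Nat.log`, and `4 q^s` comes from the box argument. -/
theorem discrepancyConst_mul_le {q s i M : ℕ} [Fact q.Prime] (hi : 1 ≤ i) (hM1 : 1 ≤ M)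
    (hM : M ≤ (s + 1) * q ^ (i + 1) + (s + 1) * q ^ i) :
    discrepancyConst q s * Real.log ((q ^ M : ℕ) : ℝ) ^ s *
      Real.log (Real.log ((q ^ M : ℕ) : ℝ)) ≤ (q : ℝ) ^ excess q s i / (4 * q ^ s) := by
  have hq : 1 < (q : ℝ) := by exact_mod_cast (Fact.out : q.Prime).one_lt
  have hl := Real.log_pos hq
  set C : ℝ := (s + 1) * (q + 1) * Real.log q with hC
  have hCpos : 0 < C := by positivity
  have hM' : (M : ℝ) ≤ (s + 1) * q ^ (i + 1) + (s + 1) * q ^ i := by exact_mod_cast hM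
  have hlogN : Real.log ((q ^ M : ℕ) : ℝ) = M * Real.log q := by
    rw [Nat.cast_pow, Real.log_pow]
  have hMpos : (0 : ℝ) < M := by exact_mod_cast hM1
  have hub : M * Real.log q ≤ C * q ^ i := by
    calc M * Real.log q ≤ ((s + 1) * q ^ (i + 1) + (s + 1) * q ^ i) * Real.log q := by gcongr
      _ = C * q ^ i := by rw [hC, pow_succ]; ring
  set B : ℝ := |Real.log C| + Real.log q with hB
  have hBpos : 0 < B := by positivity
  have hi' : (1 : ℝ) ≤ i := by exact_mod_cast hi
  have hloglog : Real.log (M * Real.log q) ≤ B * i := by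
    calc Real.log (M * Real.log q) ≤ Real.log (C * q ^ i) := Real.log_le_log (by positivity) hub
      _ = Real.log C + i * Real.log q := by
        rw [Real.log_mul hCpos.ne' (by positivity), Real.log_pow]
      _ ≤ B * i := by
        have h1 := le_abs_self (Real.log C)
        have h2 := mul_le_mul_of_nonneg_left hi' (abs_nonneg (Real.log C))
        rw [hB]
        linarith
  have hexc : ((q : ℝ) ^ i) ^ s * i ≤ q * q ^ excess q s i := by
    exact_mod_cast le_pow_excess (Fact.out : q.Prime).one_lt s i
  have hprod : (M * Real.log q) ^ s * Real.log (M * Real.log q) ≤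
      C ^ s * (B * q) * q ^ excess q s i := by
    calc (M * Real.log q) ^ s * Real.log (M * Real.log q)
        ≤ (M * Real.log q) ^ s * (B * i) := by gcongr
      _ ≤ (C * q ^ i) ^ s * (B * i) := by gcongr
      _ = C ^ s * B * ((q ^ i) ^ s * i) := by rw [mul_pow]; ring1
      _ ≤ C ^ s * B * (q * q ^ excess q s i) := by gcongr
      _ = C ^ s * (B * q) * q ^ excess q s i := by ring
  rw [hlogN, mul_assoc, discrepancyConst, ← hC, ← hB, inv_mul_le_iff₀ (by positivity)]
  refine hprod.trans (le_of_eq ?_)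
  field_simp

theorem HasSmallForm.exists_large_starDiscrepancy {q s i : ℕ} [Fact q.Prime]
    {f : Fin s → unitBall q} (hs : 1 ≤ s) (hi : 1 ≤ i) (h : HasSmallForm f i) :
    ∃ N : ℕ, i < N ∧ discrepancyConst q s * Real.log (N : ℝ) ^ s * Real.log (Real.log (N : ℝ)) ≤
      starDiscrepancy (kroneckerSeq fun j => (f j : LaurentSeries (ZMod q))) N := by
  obtain ⟨k, hk, hdeg, hf⟩ := h
  have hq := (Fact.out : q.Prime).one_lt
  -- This makes `N` exceed `i`, so infinitely many scales yield infinitely many `N`.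
  have he : i ≤ excess q s i := (Nat.le_mul_of_pos_left i hs).trans (Nat.le_add_right _ _)
  refine ⟨q ^ (∑ j, (k j).natDegree + excess q s i),
    (he.trans (Nat.le_add_left _ _)).trans_lt (Nat.lt_pow_self hq), ?_⟩
  refine (discrepancyConst_mul_le hi (by omega) ?_).trans
    (le_starDiscrepancy_of_linForm hk (by omega) hf)
  exact Nat.add_le_add hdeg (excess_le hq s i)

end

end DigitalKronecker


theorem theorem2 (q : ℕ) [Fact q.Prime] (s : ℕ) (hs : 1 ≤ s) :
    ∃ c : ℝ, 0 < c ∧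
      ∀ᵐ f ∂(DigitalKronecker.haarPi q s),
        {N : ℕ | 0 < N ∧
          c * Real.log (N : ℝ) ^ s * Real.log (Real.log (N : ℝ)) ≤
            DigitalKronecker.starDiscrepancy
              (DigitalKronecker.kroneckerSeq
                (fun j => (f j : LaurentSeries (ZMod q)))) N}.Infinite := by
  refine ⟨DigitalKronecker.discrepancyConst q s, DigitalKronecker.discrepancyConst_pos q s, ?_⟩
  filter_upwards [DigitalKronecker.ae_infinite_hasSmallForm q hs] with f hf
  rw [Set.infinite_iff_exists_gt] at hf ⊢
  intro a
  obtain ⟨i, hi, hai⟩ := hf a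
  obtain ⟨N, hN, h⟩ := hi.exists_large_starDiscrepancy hs (by omega)
  exact ⟨N, ⟨by omega, h⟩, by omega⟩
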